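/- Let $n\ge 2$ be an even integer, let $q>1$, and let $m_1,\dots,m_{n/2}$ be positive integers with $m_{k+1}/m_k\ge q$ for $1\le k<n/2$. On the interval $\Omega=(-\pi,\pi)$ with the uniform probability measure $d\mathbb P(t)=\frac{1}{2\pi}\,dt$ consider the random vector $X=(X_1,\dots,X_n)$ with components $$X_{2k-1}(t)=\sqrt2\,\cos(m_k t),\qquad X_{2k}(t)=\sqrt2\,\sin(m_k t),\qquad k=1,\dots,n/2 .$$ For $\theta$ in the unit sphere $\mathbb S^{n-1}\subset\mathbb R^n$ let $F_\theta(x)=\mathbb P\{\theta_1X_1+\dots+\theta_nX_n\le x\}$, $x\in\mathbb R$, let $\Phi$ be the standard normal distribution function, and put $$\omega(F_\theta,\Phi)=\Big(\int_{-\infty}^{\infty}(F_\theta(x)-\Phi(x))^2\,dx\Big)^{1/2},\qquad \rho(F_\theta,\Phi)=\sup_{x\in\mathbb R}|F_\theta(x)-\Phi(x)| .$$ Let $\mathbb E_\theta$ denote integration over $\mathbb S^{n-1}$ with respect to the normalized Lebesgue (uniform probability) measure. Then $$\mathbb E_\theta\,\omega^2(F_\theta,\Phi)\le\frac{c_q}{n^2},\qquad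 \mathbb E_\theta\,\rho^2(F_\theta,\Phi)\le\frac{c_q(\log n)^2}{n^2},$$ where the constant $c_q>0$ depends on $q$ only (not on $n$ or on the $m_k$). -/

import Mathlib

open MeasureTheory ProbabilityTheory Real Set

noncomputable section

/-- The normalized Lebesgue (uniform probability) measure on the unit sphere of `ℝⁿ`. -/
def sphereMeasure (n : ℕ) : Measure (Metric.sphere (0 : EuclideanSpace ℝ (Fin n)) 1) :=
  ((volume : Measure (EuclideanSpace ℝ (Fin n))).toSphere univ)⁻¹ •
    (volume : Measure (EuclideanSpace ℝ (Fin n))).toSphere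

/-- The uniform probability measure on the interval `(-π, π)`: density `1 / (2π)`. -/
def circleProb : Measure ℝ :=
  ENNReal.ofReal (1 / (2 * π)) • (volume : Measure ℝ).restrict (Ioo (-π) π)

/-- The trigonometric system with frequencies `m 1, m 2, …`. The component with index
`i : Fin n` is the `(i + 1)`-st one: the components numbered `2k - 1` and `2k` (that is,
`i = 2k - 2` and `i = 2k - 1`) are `√2 cos (m k * t)` and `√2 sin (m k * t)`. -/
def trigSystem (n : ℕ) (m : ℕ → ℕ) (i : Fin n) (t : ℝ) : ℝ :=
  if Even (i : ℕ) then √2 * cos ((m ((i : ℕ) / 2 + 1) : ℝ) * t)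
  else √2 * sin ((m ((i : ℕ) / 2 + 1) : ℝ) * t)

/-- The distribution function `x ↦ P {θ₁ X₁ + ⋯ + θₙ Xₙ ≤ x}` of a weighted sum. -/
def weightedDistFun {Ω : Type*} [MeasurableSpace Ω] (P : Measure Ω) {n : ℕ}
    (X : Fin n → Ω → ℝ) (θ : EuclideanSpace ℝ (Fin n)) (x : ℝ) : ℝ :=
  P.real {t | ∑ i, θ i * X i t ≤ x}

/-- The standard normal distribution function. -/
def stdNormalCDF (x : ℝ) : ℝ := cdf (gaussianReal 0 1) x

/-- The Kolmogorov distance between two distribution functions. -/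
def kolmogorovDist (F G : ℝ → ℝ) : ℝ := ⨆ x : ℝ, |F x - G x|

/-- The `L²`-distance between two distribution functions (for `(F - G)²` integrable). -/
def l2Dist (F G : ℝ → ℝ) : ℝ := √(∫ x : ℝ, (F x - G x) ^ 2)

/-- The finite sequence `m 1, …, m N` consists of positive integers and is lacunary with
parameter `q`: `m (k + 1) / m k ≥ q` for `1 ≤ k < N`. -/
def IsLacunary (q : ℝ) (N : ℕ) (m : ℕ → ℕ) : Prop :=
  (∀ k, 1 ≤ k → k ≤ N → 0 < m k) ∧
    ∀ k, 1 ≤ k → k < N → q ≤ (m (k + 1) : ℝ) / (m k : ℝ)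

end

/-! ### Additive combinatorics of lacunary frequencies -/

/-! Let Q be the law of X on ℝⁿ. For a fixed direction θ, both distances are controlled by D(sθ),
where D(v) = |φ_Q(v) - exp(-|v|²/2)| and φ_Q is the characteristic function of Q: Plancherel handles
the L²-distance (`ofReal_integral_cdf_sub_sq_le`), Gaussian smoothing the uniform one
(`ofReal_abs_cdf_sub_le`). So the mean of D(sθ)² over θ has to be small.

The uniform θ is replaced by x/|x| with x standard Gaussian. Length and direction of x are
independent and |x| ≥ √n/2 has probability at least 1/4, so conditioning costs a factor 4
(`lintegral_sphereMeasure_le`); rescaling s then turns sθ into (s/√n)x. The Gaussian mean of D² is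
explicit (`integral_norm_charFun_sub_exp_sq`). Since |X|² = n identically, it depends only on the
correlation ξ = ⟨X, Y⟩/n of X with an independent copy Y: with u = s² it equals exp(-u) E exp(uξ),
minus twice an elementary function, plus another one. Because E ξ = 0 and E ξ² = 1/n, the terms of
order 1 and 1/n cancel, and the sum is O(min(1, s²)/n²) as soon as E ξ³ and E ξ⁴ are O(1/n²)
(`exp_neg_mul_integral_exp_sub_add_le`).

Arithmetic enters only here. As nξ is the sum of exp(ia(t - t')) over the n frequencies a = ±m_k,
the k-th moment of nξ counts solutions of a₁ + ... + a_k = 0. For lacunary frequencies an equation a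
+ b = d with d ≠ 0 has boundedly many solutions (`IsLacunary.card_add_eq_le`), hence there are O(n)
zero-sum triples and O(n²) zero-sum quadruples.

It remains to integrate over s. For the L²-distance, min(1, s²)/s² is integrable, which gives 1/n².
For the uniform distance, smoothing at scale 1/n leaves the weight min(1, |s|)/|s| cut off near |s|
= n, of mass O(log n); Cauchy–Schwarz with this weight gives (log n)²/n². -/

theorem IsLacunary.pow_mul_le {q : ℝ} (hq : 1 < q) {N : ℕ} {m : ℕ → ℕ} (h : IsLacunary q N m)
    {k : ℕ} (hk : 1 ≤ k) (j : ℕ) (hj : k + j ≤ N) : q ^ j * (m k : ℝ) ≤ m (k + j) := by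
  induction j with
  | zero => simp
  | succ j ih =>
    have h1 := ih (by omega)
    have h2 := h.2 (k + j) (by omega) (by omega)
    have h3 : (0 : ℝ) < m (k + j) := by exact_mod_cast h.1 (k + j) (by omega) (by omega)
    rw [le_div_iff₀ h3] at h2
    calc q ^ (j + 1) * (m k : ℝ) = q * (q ^ j * m k) := by ring
      _ ≤ q * m (k + j) := by gcongr
      _ ≤ _ := h2

theorem IsLacunary.mul_le_of_lt {q : ℝ} (hq : 1 < q) {N : ℕ} {m : ℕ → ℕ} (h : IsLacunary q N m)
    {k l : ℕ} (hk : 1 ≤ k) (hkl : k < l) (hl : l ≤ N) : q * (m k : ℝ) ≤ m l := by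
  obtain ⟨j, rfl⟩ := Nat.exists_eq_add_of_lt hkl
  have h1 := h.pow_mul_le hq hk (j + 1) (by omega)
  have h3 : (0 : ℝ) < m k := by exact_mod_cast h.1 k (by omega) (by omega)
  refine le_trans ?_ h1
  gcongr
  exact le_self_pow₀ hq.le (by omega)

theorem IsLacunary.lt_of_lt {q : ℝ} (hq : 1 < q) {N : ℕ} {m : ℕ → ℕ} (h : IsLacunary q N m)
    {k l : ℕ} (hk : 1 ≤ k) (hkl : k < l) (hl : l ≤ N) : m k < m l := by
  have h1 := h.mul_le_of_lt hq hk hkl hl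
  have h3 : (0 : ℝ) < m k := by exact_mod_cast h.1 k (by omega) (by omega)
  have : (m k : ℝ) < m l := by nlinarith
  exact_mod_cast this

/-- From the smallest index in the window, L steps multiply the frequency by at least q ^ L > K and
so leave the window; its indices fit into L consecutive integers. -/
theorem IsLacunary.card_window_le {q : ℝ} (hq : 1 < q) {N : ℕ} {m : ℕ → ℕ}
    (h : IsLacunary q N m) {x K : ℝ} (hx : 0 < x) {L : ℕ} (hL : K < q ^ L) :
    ((Finset.Icc 1 N).filter (fun k => x ≤ (m k : ℝ) ∧ (m k : ℝ) ≤ K * x)).card ≤ L := by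
  set S := (Finset.Icc 1 N).filter (fun k => x ≤ (m k : ℝ) ∧ (m k : ℝ) ≤ K * x) with hS
  rcases S.eq_empty_or_nonempty with h0 | h0
  · simp [h0]
  have hk0 := S.min'_mem h0
  set k0 := S.min' h0
  simp only [hS, Finset.mem_filter, Finset.mem_Icc] at hk0
  have hsub : S ⊆ Finset.Ico k0 (k0 + L) := by
    intro l hl
    have hmin : k0 ≤ l := S.min'_le l hl
    simp only [hS, Finset.mem_filter, Finset.mem_Icc] at hl
    rw [Finset.mem_Ico]
    refine ⟨hmin, ?_⟩
    by_contra! hcon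
    have h1 := h.pow_mul_le hq hk0.1.1 (l - k0) (by omega)
    rw [Nat.add_sub_cancel' hmin] at h1
    have h2 : q ^ L ≤ q ^ (l - k0) := pow_le_pow_right₀ hq.le (by omega)
    have h3 : q ^ L * x ≤ q ^ (l - k0) * m k0 :=
      mul_le_mul h2 hk0.2.1 hx.le (by positivity)
    nlinarith [hl.2.2]
  calc S.card ≤ _ := Finset.card_le_card hsub
    _ = L := by simp

/-- The symmetric set of frequencies `± m 1, …, ± m N`. -/
def freqSet (m : ℕ → ℕ) (N : ℕ) : Finset ℤ :=
  (Finset.Icc 1 N).image (fun k => (m k : ℤ)) ∪ (Finset.Icc 1 N).image (fun k => -(m k : ℤ))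

theorem mem_freqSet {m : ℕ → ℕ} {N : ℕ} {a : ℤ} :
    a ∈ freqSet m N ↔ ∃ k, 1 ≤ k ∧ k ≤ N ∧ |a| = (m k : ℤ) := by
  simp only [freqSet, Finset.mem_union, Finset.mem_image, Finset.mem_Icc]
  constructor
  · rintro (⟨k, hk, rfl⟩ | ⟨k, hk, rfl⟩) <;> exact ⟨k, hk.1, hk.2, by simp⟩
  · rintro ⟨k, h1, h2, h3⟩
    rcases abs_choice a with h | h
    · left; exact ⟨k, ⟨h1, h2⟩, by omega⟩
    · right; exact ⟨k, ⟨h1, h2⟩, by omega⟩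

theorem neg_mem_freqSet {m : ℕ → ℕ} {N : ℕ} {a : ℤ} : -a ∈ freqSet m N ↔ a ∈ freqSet m N := by
  simp [mem_freqSet]

theorem IsLacunary.injOn {q : ℝ} (hq : 1 < q) {N : ℕ} {m : ℕ → ℕ} (h : IsLacunary q N m) :
    InjOn m (Finset.Icc 1 N : Finset ℕ) := by
  intro k hk l hl hkl
  simp only [Finset.coe_Icc, mem_Icc] at hk hl
  rcases lt_trichotomy k l with h1 | h1 | h1
  · have := h.lt_of_lt hq hk.1 h1 hl.2; omega
  · exact h1
  · have := h.lt_of_lt hq hl.1 h1 hk.2; omega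

theorem IsLacunary.sum_freqSet {M : Type*} [AddCommMonoid M] {q : ℝ} (hq : 1 < q) {N : ℕ}
    {m : ℕ → ℕ} (h : IsLacunary q N m) (g : ℤ → M) :
    ∑ a ∈ freqSet m N, g a = ∑ k ∈ Finset.Icc 1 N, (g (m k) + g (-(m k : ℤ))) := by
  have hinj := h.injOn hq
  rw [freqSet, Finset.sum_union, Finset.sum_image, Finset.sum_image, Finset.sum_add_distrib]
  · intro k hk l hl hkl
    exact hinj hk hl (by simpa using hkl)
  · intro k hk l hl hkl
    exact hinj hk hl (by simpa using hkl)
  · rw [Finset.disjoint_left]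
    intro a ha hb
    simp only [Finset.mem_image, Finset.mem_Icc] at ha hb
    obtain ⟨k, hk, rfl⟩ := ha
    obtain ⟨l, hl, h2⟩ := hb
    have := h.1 k hk.1 hk.2
    omega

theorem IsLacunary.card_freqSet {q : ℝ} (hq : 1 < q) {N : ℕ}
    {m : ℕ → ℕ} (h : IsLacunary q N m) : (freqSet m N).card = 2 * N := by
  rw [Finset.card_eq_sum_ones, h.sum_freqSet hq]
  simp [mul_comm]

theorem IsLacunary.zero_notMem {q : ℝ} {N : ℕ} {m : ℕ → ℕ} (h : IsLacunary q N m) :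
    (0 : ℤ) ∉ freqSet m N := by
  rw [mem_freqSet]
  rintro ⟨k, h1, h2, h3⟩
  have := h.1 k h1 h2
  simp at h3
  omega

theorem IsLacunary.card_freqSet_window_le {q : ℝ} (hq : 1 < q) {N : ℕ} {m : ℕ → ℕ}
    (h : IsLacunary q N m) {x K : ℝ} (hx : 0 < x) {L : ℕ} (hL : K < q ^ L) :
    ((freqSet m N).filter (fun a : ℤ => x ≤ |(a : ℝ)| ∧ |(a : ℝ)| ≤ K * x)).card ≤ 2 * L := by
  set S := (Finset.Icc 1 N).filter (fun k => x ≤ (m k : ℝ) ∧ (m k : ℝ) ≤ K * x)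
  have hS : S.card ≤ L := h.card_window_le hq hx hL
  have hsub : (freqSet m N).filter (fun a : ℤ => x ≤ |(a : ℝ)| ∧ |(a : ℝ)| ≤ K * x) ⊆
      S.image (fun k => (m k : ℤ)) ∪ S.image (fun k => -(m k : ℤ)) := by
    intro a ha
    rw [Finset.mem_filter, mem_freqSet] at ha
    obtain ⟨⟨k, h1, h2, h3⟩, h4⟩ := ha
    have h5 : |(a : ℝ)| = m k := by exact_mod_cast h3
    rw [h5] at h4
    have hk : k ∈ S := by simp [S, h1, h2, h4]
    rw [Finset.mem_union, Finset.mem_image, Finset.mem_image]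
    rcases abs_choice a with h | h
    · left; exact ⟨k, hk, by omega⟩
    · right; exact ⟨k, hk, by omega⟩
  calc _ ≤ _ := Finset.card_le_card hsub
    _ ≤ _ := Finset.card_union_le _ _
    _ ≤ S.card + S.card := add_le_add Finset.card_image_le Finset.card_image_le
    _ ≤ 2 * L := by omega

theorem IsLacunary.mul_abs_le_of_abs_lt {q : ℝ} (hq : 1 < q) {N : ℕ} {m : ℕ → ℕ}
    (h : IsLacunary q N m) {a b : ℤ} (ha : a ∈ freqSet m N) (hb : b ∈ freqSet m N)
    (hab : |a| < |b|) : q * |(a : ℝ)| ≤ |(b : ℝ)| := by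
  obtain ⟨k, h1, h2, h3⟩ := mem_freqSet.1 ha
  obtain ⟨l, g1, g2, g3⟩ := mem_freqSet.1 hb
  have hkl : k < l := by
    by_contra! hcon
    rcases hcon.eq_or_lt with rfl | hlt
    · omega
    · have := h.lt_of_lt hq g1 hlt h2; omega
  have h5 : |(a : ℝ)| = m k := by exact_mod_cast h3
  have h6 : |(b : ℝ)| = m l := by exact_mod_cast g3
  rw [h5, h6]
  exact h.mul_le_of_lt hq h1 hkl g2

/-- The larger summand in a representation `a + b = d ≠ 0` by lacunary frequencies is
comparable with `d`. -/
theorem IsLacunary.abs_mem_window {q : ℝ} (hq : 1 < q) {N : ℕ} {m : ℕ → ℕ}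
    (h : IsLacunary q N m) {a b d : ℤ} (ha : a ∈ freqSet m N) (hb : b ∈ freqSet m N)
    (hd : d ≠ 0) (hab : a + b = d) (hle : |b| ≤ |a|) :
    |(d : ℝ)| / 2 ≤ |(a : ℝ)| ∧ |(a : ℝ)| ≤ (2 * q / (q - 1)) * (|(d : ℝ)| / 2) := by
  have hdR : (d : ℝ) = a + b := by exact_mod_cast hab.symm
  have hleR : |(b : ℝ)| ≤ |(a : ℝ)| := by exact_mod_cast hle
  have hq1 : 0 < q - 1 := by linarith
  have htri : |(d : ℝ)| ≤ |(a : ℝ)| + |(b : ℝ)| := hdR ▸ abs_add_le _ _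
  have htri2 : |(a : ℝ)| - |(b : ℝ)| ≤ |(d : ℝ)| := by
    have := abs_sub_abs_le_abs_sub (a : ℝ) (-b)
    rwa [abs_neg, sub_neg_eq_add, ← hdR] at this
  refine ⟨by linarith, ?_⟩
  -- If |b| < |a|, lacunarity gives |b| ≤ |a|/q, so little cancellation is possible. If |b| = |a|,
  -- then b = -a is excluded by d ≠ 0, and d = 2a.
  have hkey : (q - 1) * |(a : ℝ)| ≤ q * |(d : ℝ)| := by
    rcases hle.lt_or_eq with hlt | heq
    · have := h.mul_abs_le_of_abs_lt hq hb ha hlt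
      nlinarith
    · have hbb : b = a := by
        rcases abs_eq_abs.1 heq with h1 | h1
        · exact h1
        · omega
      subst hbb
      have : |(d : ℝ)| = 2 * |(b : ℝ)| := by rw [hdR, ← two_mul, abs_mul]; simp
      rw [this]
      nlinarith [abs_nonneg (b : ℝ)]
  rw [div_mul_div_comm, le_div_iff₀ (by linarith)]
  nlinarith

/-- The larger summand lies in a window of ratio 2q/(q - 1) starting at |d|/2, which contains at
most 2L signed frequencies, and it determines the other summand. A further factor 2 accounts for
which of the two is larger. -/
theorem IsLacunary.card_add_eq_le {q : ℝ} (hq : 1 < q) {N : ℕ} {m : ℕ → ℕ}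
    (h : IsLacunary q N m) {L : ℕ} (hL : 2 * q / (q - 1) < q ^ L) {d : ℤ} (hd : d ≠ 0) :
    ((freqSet m N ×ˢ freqSet m N).filter (fun p => p.1 + p.2 = d)).card ≤ 4 * L := by
  set W := (freqSet m N).filter
    (fun a : ℤ => |(d : ℝ)| / 2 ≤ |(a : ℝ)| ∧ |(a : ℝ)| ≤ (2 * q / (q - 1)) * (|(d : ℝ)| / 2))
  have hdpos : 0 < |(d : ℝ)| / 2 := by
    have : (d : ℝ) ≠ 0 := by exact_mod_cast hd
    positivity
  have hW : W.card ≤ 2 * L := h.card_freqSet_window_le hq hdpos hL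
  have hsub : (freqSet m N ×ˢ freqSet m N).filter (fun p => p.1 + p.2 = d) ⊆
      W.image (fun a => (a, d - a)) ∪ W.image (fun a => (d - a, a)) := by
    rintro ⟨a, b⟩ hp
    simp only [Finset.mem_filter, Finset.mem_product] at hp
    obtain ⟨⟨ha, hb⟩, hab⟩ := hp
    rw [Finset.mem_union, Finset.mem_image, Finset.mem_image]
    rcases le_total |b| |a| with hle | hle
    · left
      refine ⟨a, ?_, by ext <;> simp; omega⟩
      exact Finset.mem_filter.2 ⟨ha, h.abs_mem_window hq ha hb hd hab hle⟩
    · right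
      refine ⟨b, ?_, by ext <;> simp; omega⟩
      exact Finset.mem_filter.2 ⟨hb, h.abs_mem_window hq hb ha hd (by omega) hle⟩
  calc _ ≤ _ := Finset.card_le_card hsub
    _ ≤ _ := Finset.card_union_le _ _
    _ ≤ W.card + W.card := add_le_add Finset.card_image_le Finset.card_image_le
    _ ≤ 4 * L := by omega

theorem card_add_eq_zero (m : ℕ → ℕ) (N : ℕ) :
    ((freqSet m N ×ˢ freqSet m N).filter (fun p => p.1 + p.2 = 0)).card = (freqSet m N).card := by
  refine Finset.card_bij' (fun p _ => p.1) (fun a _ => (a, -a)) ?_ ?_ ?_ ?_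
  · intro p hp; simp only [Finset.mem_filter, Finset.mem_product] at hp; exact hp.1.1
  · intro a ha; simp [ha, neg_mem_freqSet]
  · intro p hp
    simp only [Finset.mem_filter, Finset.mem_product] at hp
    ext <;> simp; omega
  · intro a ha; rfl

theorem IsLacunary.card_add_add_eq_zero_le {q : ℝ} (hq : 1 < q) {N : ℕ} {m : ℕ → ℕ}
    (h : IsLacunary q N m) {L : ℕ} (hL : 2 * q / (q - 1) < q ^ L) :
    ∑ a ∈ freqSet m N, ((freqSet m N ×ˢ freqSet m N).filter (fun p => p.1 + p.2 = -a)).card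
      ≤ 4 * L * (freqSet m N).card := by
  rw [mul_comm, ← smul_eq_mul]
  refine Finset.sum_le_card_nsmul _ _ _ fun a ha => h.card_add_eq_le hq hL ?_
  rintro h0
  rw [neg_eq_zero] at h0
  exact h.zero_notMem (h0 ▸ ha)

/-- Zero-sum quadruples are grouped by the sum of one pair. The n pairs with sum zero each have n
partners; each of the at most n² remaining pairs has at most 4L, where n is the number of
frequencies. This keeps the fourth moment at its diagonal order. -/
theorem IsLacunary.card_add_eq_add_le {q : ℝ} (hq : 1 < q) {N : ℕ} {m : ℕ → ℕ}
    (h : IsLacunary q N m) {L : ℕ} (hL : 2 * q / (q - 1) < q ^ L) :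
    ∑ r ∈ freqSet m N ×ˢ freqSet m N,
      ((freqSet m N ×ˢ freqSet m N).filter (fun p => p.1 + p.2 = -(r.1 + r.2))).card
      ≤ (4 * L + 1) * (freqSet m N).card ^ 2 := by
  set A := freqSet m N
  rw [← Finset.sum_filter_add_sum_filter_not (A ×ˢ A) (fun r => r.1 + r.2 = 0)]
  have h1 : ∑ r ∈ (A ×ˢ A) with r.1 + r.2 = 0,
      ((A ×ˢ A).filter (fun p => p.1 + p.2 = -(r.1 + r.2))).card = A.card * A.card := by
    rw [Finset.sum_congr rfl (g := fun _ => A.card)]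
    · rw [Finset.sum_const, card_add_eq_zero, smul_eq_mul]
    · intro r hr
      rw [(Finset.mem_filter.1 hr).2, neg_zero, card_add_eq_zero]
  have h2 : ∑ r ∈ (A ×ˢ A) with ¬ r.1 + r.2 = 0,
      ((A ×ˢ A).filter (fun p => p.1 + p.2 = -(r.1 + r.2))).card ≤ (A.card * A.card) * (4 * L) := by
    refine (Finset.sum_le_card_nsmul _ _ (4 * L) fun r hr => h.card_add_eq_le hq hL ?_).trans ?_
    · rw [neg_ne_zero]; exact (Finset.mem_filter.1 hr).2
    · rw [smul_eq_mul]
      gcongr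
      exact (Finset.card_filter_le _ _).trans (by simp)
  rw [h1]
  nlinarith

/-! ### Elementary exponential estimates -/

theorem exp_le_cubic_add_of_nonneg {y : ℝ} (hy : 0 ≤ y) :
    exp y ≤ 1 + y + y ^ 2 / 2 + y ^ 3 / 6 + y ^ 4 * exp y := by
  have h := Complex.norm_exp_sub_sum_le_norm_mul_exp (y : ℂ) 4
  have h2 : Complex.exp (y : ℂ) - ∑ m ∈ Finset.range 4, (y : ℂ) ^ m / (m.factorial : ℂ) =
      ((exp y - (1 + y + y ^ 2 / 2 + y ^ 3 / 6) : ℝ) : ℂ) := by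
    simp [Finset.sum_range_succ, Nat.factorial]
  rw [h2, Complex.norm_real, Complex.norm_real, norm_of_nonneg hy, norm_eq_abs] at h
  linarith [le_abs_self (exp y - (1 + y + y ^ 2 / 2 + y ^ 3 / 6))]

theorem exp_le_linear_add_of_nonneg {y : ℝ} (hy : 0 ≤ y) :
    exp y ≤ 1 + y + y ^ 2 * exp y := by
  have h := Complex.norm_exp_sub_sum_le_norm_mul_exp (y : ℂ) 2
  have h2 : Complex.exp (y : ℂ) - ∑ m ∈ Finset.range 2, (y : ℂ) ^ m / (m.factorial : ℂ) =
      ((exp y - (1 + y) : ℝ) : ℂ) := by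
    simp [Finset.sum_range_succ, Nat.factorial]
  rw [h2, Complex.norm_real, Complex.norm_real, norm_of_nonneg hy, norm_eq_abs] at h
  linarith [le_abs_self (exp y - (1 + y))]

/-- On the negative axis the quartic remainder needs no exponential factor: on [-1, 0] the Taylor
remainder carries at most e < 3, and below -1 the quartic dominates while exp y ≤ 1. -/
theorem exp_le_cubic_add_of_nonpos {y : ℝ} (hy : y ≤ 0) :
    exp y ≤ 1 + y + y ^ 2 / 2 + y ^ 3 / 6 + 3 * y ^ 4 := by
  rcases le_total (-1) y with h1 | h1
  · have h := Complex.norm_exp_sub_sum_le_norm_mul_exp (y : ℂ) 4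
    have h2 : Complex.exp (y : ℂ) - ∑ m ∈ Finset.range 4, (y : ℂ) ^ m / (m.factorial : ℂ) =
        ((exp y - (1 + y + y ^ 2 / 2 + y ^ 3 / 6) : ℝ) : ℂ) := by
      simp [Finset.sum_range_succ, Nat.factorial]
    rw [h2, Complex.norm_real, Complex.norm_real, norm_eq_abs, norm_eq_abs] at h
    have h3 : |y| ≤ 1 := abs_le.2 ⟨h1, by linarith⟩
    have h4 : exp |y| ≤ 3 := (exp_le_exp.2 h3).trans (by linarith [exp_one_lt_d9])
    have h5 : |y| ^ 4 = y ^ 4 := (by decide : Even 4).pow_abs y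
    rw [h5] at h
    have h6 : y ^ 4 * exp |y| ≤ y ^ 4 * 3 := by gcongr
    linarith [le_abs_self (exp y - (1 + y + y ^ 2 / 2 + y ^ 3 / 6))]
  · have h3 : exp y ≤ 1 := exp_le_one_iff.2 hy
    have h4 : 1 ≤ y ^ 2 := by nlinarith
    nlinarith [mul_nonneg (neg_nonneg.2 hy) (sub_nonneg.2 h4), sq_nonneg (y ^ 2 - 1),
      sq_nonneg (y * (y + 1)), sq_nonneg (y + 1), sq_nonneg y]

theorem pow_mul_exp_neg_le {x : ℝ} (hx : 0 ≤ x) (k : ℕ) :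
    x ^ k * exp (-x) ≤ k.factorial := by
  have h := pow_div_factorial_le_exp x hx k
  rw [div_le_iff₀ (by positivity)] at h
  rw [exp_neg, ← div_eq_mul_inv, div_le_iff₀ (exp_pos _)]
  linarith

/-- Here 384 = 2⁴ · 4!. The factor min 1 u is kept because, at u = s², it will compensate the
singularity 1/s² in the frequency integral. -/
theorem pow_four_mul_exp_neg_half_le {u : ℝ} (hu : 0 ≤ u) :
    u ^ 4 * exp (-(u / 2)) ≤ 384 * min 1 u := by
  have h4 := pow_mul_exp_neg_le (by positivity : 0 ≤ u / 2) 4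
  have h3 := pow_mul_exp_neg_le (by positivity : 0 ≤ u / 2) 3
  norm_num [Nat.factorial] at h3 h4
  rcases min_cases (1 : ℝ) u with ⟨h, _⟩ | ⟨h, _⟩ <;> rw [h]
  · nlinarith
  · nlinarith

theorem pow_three_mul_exp_neg_le {u : ℝ} (hu : 0 ≤ u) :
    u ^ 3 * exp (-u) ≤ 6 * min 1 u := by
  have h4 := pow_mul_exp_neg_le hu 3
  have h3 := pow_mul_exp_neg_le hu 2
  norm_num [Nat.factorial] at h3 h4
  rcases min_cases (1 : ℝ) u with ⟨h, _⟩ | ⟨h, _⟩ <;> rw [h]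
  · nlinarith
  · nlinarith

/-- Third-order Taylor expansion in y whose error is uniform in u. For y ≤ 1/2 the factor exp(-u(1 -
y)) still decays like exp(-u/2) and absorbs u⁴. For y near 1 there is no decay, but then y⁴ ≥ 1/16,
so for u ≥ 1 the error term alone exceeds the left side, and for u ≤ 1 the bound u⁴ ≤ u suffices.
The constant comes from 3 · 384 = 1152 in the case y ≤ 0. -/
theorem exp_neg_mul_exp_le {u y : ℝ} (hu : 0 ≤ u) (hy : |y| ≤ 1) :
    exp (-u) * exp (u * y) ≤
      exp (-u) * (1 + u * y + u ^ 2 * y ^ 2 / 2 + u ^ 3 * y ^ 3 / 6) + 1200 * min 1 u * y ^ 4 := by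
  obtain ⟨hy1, hy2⟩ := abs_le.1 hy
  have hmin : 0 ≤ min 1 u := le_min zero_le_one hu
  have hy4 : 0 ≤ y ^ 4 := by positivity
  rcases le_total y 0 with h0 | h0
  · have h1 := exp_le_cubic_add_of_nonpos (mul_nonpos_of_nonneg_of_nonpos hu h0)
    have h2 := pow_four_mul_exp_neg_half_le hu
    have h3 : exp (-u) ≤ exp (-(u / 2)) := exp_le_exp.2 (by linarith)
    have h4 : u ^ 4 * exp (-u) ≤ 384 * min 1 u := (by gcongr : _ ≤ u ^ 4 * exp (-(u / 2))).trans h2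
    have h5 := mul_le_mul_of_nonneg_left h1 (exp_pos (-u)).le
    have h6 := mul_le_mul_of_nonneg_right h4 hy4
    nlinarith
  have h1 := exp_le_cubic_add_of_nonneg (mul_nonneg hu h0)
  have h5 := mul_le_mul_of_nonneg_left h1 (exp_pos (-u)).le
  rcases le_total y (1 / 2) with h7 | h7
  · have h2 := pow_four_mul_exp_neg_half_le hu
    have h3 : exp (-u) * exp (u * y) ≤ exp (-(u / 2)) := by
      rw [← exp_add]; exact exp_le_exp.2 (by nlinarith)
    have h4 : u ^ 4 * (exp (-u) * exp (u * y)) ≤ 384 * min 1 u :=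
      (by gcongr : _ ≤ u ^ 4 * exp (-(u / 2))).trans h2
    have h6 := mul_le_mul_of_nonneg_right h4 hy4
    nlinarith
  · have h3 : exp (-u) * exp (u * y) ≤ 1 := by
      rw [← exp_add]; exact exp_le_one_iff.2 (by nlinarith)
    rcases le_total u 1 with hu1 | hu1
    · rw [min_eq_right hu1]
      have h8 : u ^ 4 ≤ u := by
        simpa using pow_le_pow_of_le_one hu hu1 (by norm_num : 1 ≤ 4)
      have h9 : u ^ 4 * y ^ 4 * (exp (-u) * exp (u * y)) ≤ u * y ^ 4 * 1 := by gcongr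
      nlinarith [mul_nonneg hu hy4]
    · rw [min_eq_left hu1]
      have h8 : (1 / 2) ^ 4 ≤ y ^ 4 := by gcongr
      have h9 : 0 ≤ exp (-u) * (1 + u * y + u ^ 2 * y ^ 2 / 2 + u ^ 3 * y ^ 3 / 6) := by positivity
      norm_num at h8
      linarith

/-- For u ≤ ν/2, the bound log(1 + x) ≥ x - x²/2 at x = 2u/ν produces the exponent -u + u²/ν, and
u²/ν ≤ u/2 leaves enough decay for a first-order expansion. For u ≥ ν/2 the left side is at most
2^(-ν/2), which is already O(1/ν²). -/
theorem one_add_two_mul_rpow_le {u ν : ℝ} (hu : 0 ≤ u) (hν : 2 ≤ ν) :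
    (1 + 2 * (u / ν)) ^ (-(ν / 2)) ≤ exp (-u) * (1 + u ^ 2 / ν) + 400 * min 1 u / ν ^ 2 := by
  have hν0 : 0 < ν := by linarith
  have hpos : 0 < 1 + 2 * (u / ν) := by positivity
  rcases le_total u (ν / 2) with h | h
  · have hlog : 2 * (u / ν) - 2 * (u / ν) ^ 2 ≤ log (1 + 2 * (u / ν)) := by
      refine le_trans ?_ (le_log_one_add_of_nonneg (by positivity : 0 ≤ 2 * (u / ν)))
      rw [le_div_iff₀ (by positivity)]
      have : 0 ≤ (u / ν) ^ 3 := by positivity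
      nlinarith
    have h1 : (1 + 2 * (u / ν)) ^ (-(ν / 2)) ≤ exp (-u + u ^ 2 / ν) := by
      rw [rpow_def_of_pos hpos]
      apply exp_le_exp.2
      have h2 : ν / 2 * (2 * (u / ν) - 2 * (u / ν) ^ 2) ≤ ν / 2 * log (1 + 2 * (u / ν)) := by
        gcongr
      have h3 : ν / 2 * (2 * (u / ν) - 2 * (u / ν) ^ 2) = u - u ^ 2 / ν := by
        field_simp
      linarith
    have hy : u ^ 2 / ν ≤ u / 2 := by
      rw [div_le_iff₀ hν0]; nlinarith
    have h2 := exp_le_linear_add_of_nonneg (by positivity : 0 ≤ u ^ 2 / ν)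
    have h3 : exp (-u) * exp (u ^ 2 / ν) ≤ exp (-(u / 2)) := by
      rw [← exp_add]; exact exp_le_exp.2 (by linarith)
    have h4 : u ^ 4 * (exp (-u) * exp (u ^ 2 / ν)) ≤ 384 * min 1 u :=
      (by gcongr : _ ≤ u ^ 4 * exp (-(u / 2))).trans (pow_four_mul_exp_neg_half_le hu)
    have h5 : exp (-u) * ((u ^ 2 / ν) ^ 2 * exp (u ^ 2 / ν)) ≤ 400 * min 1 u / ν ^ 2 := by
      have : exp (-u) * ((u ^ 2 / ν) ^ 2 * exp (u ^ 2 / ν)) =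
          u ^ 4 * (exp (-u) * exp (u ^ 2 / ν)) / ν ^ 2 := by field_simp
      rw [this]
      refine div_le_div_of_nonneg_right (h4.trans ?_) (by positivity)
      have : 0 ≤ min 1 u := le_min zero_le_one hu
      linarith
    rw [exp_add] at h1
    have h6 := mul_le_mul_of_nonneg_left h2 (exp_pos (-u)).le
    linarith
  · have hu1 : 1 ≤ u := by linarith
    rw [min_eq_left hu1]
    have h1 : (2 : ℝ) ≤ 1 + 2 * (u / ν) := by
      have : 1 / 2 ≤ u / ν := by rw [le_div_iff₀ hν0]; linarith
      linarith
    have h2 : (1 + 2 * (u / ν)) ^ (-(ν / 2)) ≤ (2 : ℝ) ^ (-(ν / 2)) :=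
      rpow_le_rpow_of_nonpos (by norm_num) h1 (by linarith)
    have h3 : (2 : ℝ) ^ (-(ν / 2)) ≤ 400 * 1 / ν ^ 2 := by
      have hl := log_two_gt_d9
      have h4 := pow_mul_exp_neg_le (by positivity : 0 ≤ log 2 * (ν / 2)) 2
      rw [rpow_def_of_pos (by norm_num), mul_neg, le_div_iff₀ (by positivity)]
      norm_num [Nat.factorial] at h4
      have h5 : (1 / 100 : ℝ) ≤ (log 2 / 2) ^ 2 := by nlinarith
      have h6 : 0 ≤ exp (-(log 2 * (ν / 2))) * ν ^ 2 := by positivity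
      nlinarith
    have h4 : 0 ≤ exp (-u) * (1 + u ^ 2 / ν) := by positivity
    linarith

/-- With a = u/ν, the inequality x ≤ sinh x at x = log(1 + a) bounds minus the total exponent by u -
(3/4)νa²/(1 + a); then 1/(1 + a) ≥ 1 - a and exp z ≥ 1 + z. A lower bound is what is needed, since
this term enters with the coefficient -2. -/
theorem le_one_add_rpow_mul_exp {u ν : ℝ} (hu : 0 ≤ u) (hν : 2 ≤ ν) :
    exp (-u) * (1 + 3 / 4 * u ^ 2 / ν - 3 / 4 * u ^ 3 / ν ^ 2) ≤
      (1 + u / ν) ^ (-(ν / 2)) * exp (-(u / (2 * (1 + u / ν)))) := by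
  have hν0 : 0 < ν := by linarith
  set a := u / ν with ha
  have ha0 : 0 ≤ a := by positivity
  have hua : u = ν * a := by rw [ha]; field_simp
  have hlog : log (1 + a) ≤ ((1 + a) - (1 + a)⁻¹) / 2 := by
    rw [← sinh_log (by positivity)]
    exact self_le_sinh_iff.2 (log_nonneg (by linarith))
  have hinv : (1 + a)⁻¹ ≤ 1 - a + a ^ 2 := by
    rw [inv_le_iff_one_le_mul₀ (by positivity)]
    have : 0 ≤ a ^ 3 := by positivity
    nlinarith
  have hkey : log (1 + a) * (ν / 2) + u / (2 * (1 + a)) ≤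
      u - (3 / 4 * u ^ 2 / ν - 3 / 4 * u ^ 3 / ν ^ 2) := by
    have h1 : log (1 + a) * (ν / 2) ≤ ((1 + a) - (1 + a)⁻¹) / 2 * (ν / 2) := by gcongr
    have h2 : u / (2 * (1 + a)) = ν / 2 * (1 - (1 + a)⁻¹) := by
      rw [hua]; field_simp; ring
    have h3 : 3 / 4 * u ^ 2 / ν - 3 / 4 * u ^ 3 / ν ^ 2 = 3 / 4 * ν * (a ^ 2 - a ^ 3) := by
      rw [hua]; field_simp
    have h4 : a ^ 2 - a ^ 3 ≤ a ^ 2 * (1 + a)⁻¹ := by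
      rw [← div_eq_mul_inv, le_div_iff₀ (by positivity)]
      have : 0 ≤ a ^ 4 := by positivity
      nlinarith
    have h5 : a ^ 2 * (1 + a)⁻¹ = a - 1 + (1 + a)⁻¹ := by field_simp; ring
    rw [h3, h2]
    rw [h5] at h4
    have h6 := mul_le_mul_of_nonneg_left h4 hν0.le
    nlinarith
  rw [rpow_def_of_pos (by positivity), ← exp_add]
  have h1 : exp (-u + (3 / 4 * u ^ 2 / ν - 3 / 4 * u ^ 3 / ν ^ 2)) ≤
      exp (log (1 + a) * -(ν / 2) + -(u / (2 * (1 + a)))) := exp_le_exp.2 (by linarith)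
  refine le_trans ?_ h1
  rw [exp_add]
  gcongr
  linarith [add_one_le_exp (3 / 4 * u ^ 2 / ν - 3 / 4 * u ^ 3 / ν ^ 2)]

/-- The bound on the mean square distance between characteristic functions, given the first four
moments of the normalized correlation `ξ`. -/
theorem exp_neg_mul_integral_exp_sub_add_le {Ω : Type*} [MeasurableSpace Ω] (P : Measure Ω)
    [IsProbabilityMeasure P] {ξ : Ω → ℝ} (hξm : Measurable ξ) (hξ : ∀ ω, |ξ ω| ≤ 1)
    {ν A : ℝ} (hν : 2 ≤ ν) (hA : 0 ≤ A) (h1 : ∫ ω, ξ ω ∂P = 0) (h2 : ∫ ω, ξ ω ^ 2 ∂P = 1 / ν)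
    (h3 : ∫ ω, ξ ω ^ 3 ∂P ≤ A / ν ^ 2) (h4 : ∫ ω, ξ ω ^ 4 ∂P ≤ A / ν ^ 2) {u : ℝ} (hu : 0 ≤ u) :
    exp (-u) * (∫ ω, exp (u * ξ ω) ∂P)
      - 2 * ((1 + u / ν) ^ (-(ν / 2)) * exp (-(u / (2 * (1 + u / ν)))))
      + (1 + 2 * (u / ν)) ^ (-(ν / 2)) ≤ (1201 * A + 409) * min 1 u / ν ^ 2 := by
  have hν0 : 0 < ν := by linarith
  have hint : ∀ k : ℕ, Integrable (fun ω => ξ ω ^ k) P := fun k =>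
    Integrable.of_bound (hξm.pow_const k).aestronglyMeasurable 1
      (Filter.Eventually.of_forall fun ω => by
        rw [norm_pow, norm_eq_abs]; exact pow_le_one₀ (abs_nonneg _) (hξ ω))
  have i1 : Integrable (fun ω => ξ ω) P := by simpa using hint 1
  have iexp : Integrable (fun ω => exp (u * ξ ω)) P :=
    Integrable.of_bound (by fun_prop) (exp u)
      (Filter.Eventually.of_forall fun ω => by
        rw [norm_of_nonneg (exp_pos _).le]
        exact exp_le_exp.2 (by nlinarith [(abs_le.1 (hξ ω)).2]))
  have hmain : exp (-u) * (∫ ω, exp (u * ξ ω) ∂P) ≤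
      exp (-u) * (1 + u ^ 2 / (2 * ν)) + 1201 * A * min 1 u / ν ^ 2 := by
    have hle : ∫ ω, exp (-u) * exp (u * ξ ω) ∂P ≤
        ∫ ω, (exp (-u) + exp (-u) * u * ξ ω + exp (-u) * u ^ 2 / 2 * ξ ω ^ 2
          + exp (-u) * u ^ 3 / 6 * ξ ω ^ 3 + 1200 * min 1 u * ξ ω ^ 4) ∂P := by
      refine integral_mono (iexp.const_mul _) ?_ fun ω => ?_
      · exact ((((integrable_const _).add (i1.const_mul _)).add ((hint 2).const_mul _)).add
          ((hint 3).const_mul _)).add ((hint 4).const_mul _)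
      · refine (exp_neg_mul_exp_le hu (hξ ω)).trans (le_of_eq ?_)
        ring
    rw [integral_const_mul] at hle
    rw [integral_add, integral_add, integral_add, integral_add, integral_const_mul,
      integral_const_mul, integral_const_mul, integral_const_mul, h1, h2] at hle
    rotate_left
    · exact integrable_const _
    · exact i1.const_mul _
    · exact (integrable_const _).add (i1.const_mul _)
    · exact (hint 2).const_mul _
    · exact ((integrable_const _).add (i1.const_mul _)).add ((hint 2).const_mul _)
    · exact (hint 3).const_mul _
    · exact (((integrable_const _).add (i1.const_mul _)).add ((hint 2).const_mul _)).add
          ((hint 3).const_mul _)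
    · exact (hint 4).const_mul _
    simp only [integral_const, probReal_univ, smul_eq_mul, one_mul, mul_zero, add_zero] at hle
    have hm : 0 ≤ min 1 u := le_min zero_le_one hu
    have hb3 : exp (-u) * u ^ 3 / 6 * ∫ ω, ξ ω ^ 3 ∂P ≤ min 1 u * (A / ν ^ 2) := by
      have := pow_three_mul_exp_neg_le hu
      calc _ ≤ exp (-u) * u ^ 3 / 6 * (A / ν ^ 2) := by gcongr
        _ ≤ _ := by
          apply mul_le_mul_of_nonneg_right _ (by positivity)
          linarith
    have hb4 : 1200 * min 1 u * ∫ ω, ξ ω ^ 4 ∂P ≤ 1200 * min 1 u * (A / ν ^ 2) := by gcongr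
    have e1 : exp (-u) * u ^ 2 / 2 * (1 / ν) = exp (-u) * (u ^ 2 / (2 * ν)) := by field_simp
    have e2 : 1201 * A * min 1 u / ν ^ 2 = 1201 * (min 1 u * (A / ν ^ 2)) := by ring
    rw [e1] at hle
    rw [e2]
    linarith
  have hB := le_one_add_rpow_mul_exp hu hν
  have hD := one_add_two_mul_rpow_le hu hν
  have hC : exp (-u) * (3 / 2 * u ^ 3 / ν ^ 2) ≤ 9 * min 1 u / ν ^ 2 := by
    have := pow_three_mul_exp_neg_le hu
    rw [mul_div_assoc', div_le_div_iff_of_pos_right (by positivity)]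
    linarith
  -- The coefficient 1201 collects 1200 from the fourth moment and 1 from the third; 409 is 400 from
  -- the last term and 9 from the cubic correction of the cross term.
  have e3 : (1201 * A + 409) * min 1 u / ν ^ 2 =
      1201 * A * min 1 u / ν ^ 2 + 400 * min 1 u / ν ^ 2 + 9 * min 1 u / ν ^ 2 := by ring
  -- The decisive cancellation: the constants 1 - 2 + 1 and the coefficients 1/2 - 3/2 + 1 of u²/ν
  -- both vanish.
  have e4 : exp (-u) * (1 + u ^ 2 / (2 * ν)) - 2 * (exp (-u) *
      (1 + 3 / 4 * u ^ 2 / ν - 3 / 4 * u ^ 3 / ν ^ 2)) + exp (-u) * (1 + u ^ 2 / ν) =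
      exp (-u) * (3 / 2 * u ^ 3 / ν ^ 2) := by
    field_simp; ring
  rw [e3]
  linarith

/-! ### Gaussian averages of characteristic functions -/

/-- The standard Gaussian measure on `ℝⁿ`, defined by its density. -/
noncomputable def stdGaussMeasure (n : ℕ) : Measure (EuclideanSpace ℝ (Fin n)) :=
  volume.withDensity fun x => ENNReal.ofReal ((2 * π) ^ (-(n / 2 : ℝ)) * exp (-‖x‖ ^ 2 / 2))

theorem integral_stdGaussMeasure {n : ℕ} (g : EuclideanSpace ℝ (Fin n) → ℂ) :
    ∫ x, g x ∂(stdGaussMeasure n) =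
      ∫ x, (((2 * π) ^ (-(n / 2 : ℝ)) * exp (-‖x‖ ^ 2 / 2) : ℝ) : ℂ) * g x := by
  rw [stdGaussMeasure, integral_withDensity_eq_integral_toReal_smul (by fun_prop)
    (Filter.Eventually.of_forall fun _ => ENNReal.ofReal_lt_top)]
  refine integral_congr_ae (Filter.Eventually.of_forall fun x => ?_)
  simp only
  rw [ENNReal.toReal_ofReal (by positivity), Complex.real_smul]

/-- This single Gaussian integral supplies all three terms of the expanded mean square: a = 0 for
the squared characteristic function, a = c² for the cross term, w = 0 and a = 2c² for the squared
normal one. The case w = 0, a = 1 also controls the length of a Gaussian vector. -/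
theorem integral_cexp_inner_mul_exp_stdGaussMeasure {n : ℕ} (w : EuclideanSpace ℝ (Fin n))
    {a : ℝ} (ha : 0 ≤ a) :
    ∫ x, Complex.exp ((inner ℝ w x : ℝ) * Complex.I) * (exp (-(a * ‖x‖ ^ 2 / 2)) : ℝ)
      ∂(stdGaussMeasure n) =
      (((1 + a) ^ (-(n / 2 : ℝ)) * exp (-(‖w‖ ^ 2 / (2 * (1 + a)))) : ℝ) : ℂ) := by
  have hb : 0 < (((1 + a) / 2 : ℝ) : ℂ).re := by
    rw [Complex.ofReal_re]; positivity
  have h := GaussianFourier.integral_cexp_neg_mul_sq_norm_add hb Complex.I w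
  rw [integral_stdGaussMeasure]
  have hpi : (0 : ℝ) < 2 * π := by positivity
  have h1 : ∀ x : EuclideanSpace ℝ (Fin n),
      (((2 * π) ^ (-(n / 2 : ℝ)) * exp (-‖x‖ ^ 2 / 2) : ℝ) : ℂ) *
        (Complex.exp ((inner ℝ w x : ℝ) * Complex.I) * (exp (-(a * ‖x‖ ^ 2 / 2)) : ℝ)) =
      (((2 * π) ^ (-(n / 2 : ℝ)) : ℝ) : ℂ) *
        Complex.exp (-(((1 + a) / 2 : ℝ) : ℂ) * ‖x‖ ^ 2 + Complex.I * (inner ℝ w x : ℝ)) := by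
    intro x
    rw [Complex.ofReal_mul, mul_assoc, Complex.ofReal_exp, Complex.ofReal_exp, ← Complex.exp_add,
      ← Complex.exp_add]
    congr 2
    push_cast
    ring
  simp_rw [h1]
  rw [integral_const_mul, h, finrank_euclideanSpace_fin]
  have h2 : ((π : ℂ) / (((1 + a) / 2 : ℝ) : ℂ)) ^ ((n : ℂ) / 2) =
      (((2 * π / (1 + a)) ^ (n / 2 : ℝ) : ℝ) : ℂ) := by
    rw [Complex.ofReal_cpow (by positivity)]
    congr 1
    · push_cast; field_simp
    · push_cast; ring
  have h3 : Complex.exp (Complex.I ^ 2 * ‖w‖ ^ 2 / (4 * (((1 + a) / 2 : ℝ) : ℂ))) =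
      ((exp (-(‖w‖ ^ 2 / (2 * (1 + a)))) : ℝ) : ℂ) := by
    rw [Complex.ofReal_exp]
    congr 1
    have : (1 + (a : ℂ)) ≠ 0 := by exact_mod_cast (by positivity : (1 + a) ≠ 0)
    push_cast
    rw [Complex.I_sq]
    field_simp
    ring
  rw [h2, h3, ← Complex.ofReal_mul, ← Complex.ofReal_mul, ← mul_assoc]
  congr 3
  rw [div_rpow (by positivity) (by positivity), rpow_neg (by positivity), rpow_neg (by positivity)]
  field_simp

instance isProbabilityMeasure_stdGaussMeasure (n : ℕ) :
    IsProbabilityMeasure (stdGaussMeasure n) := by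
  constructor
  rw [stdGaussMeasure, withDensity_apply _ MeasurableSet.univ, Measure.restrict_univ,
    ← ofReal_integral_eq_lintegral_ofReal]
  · rw [integral_const_mul]
    have h := GaussianFourier.integral_rexp_neg_mul_sq_norm
      (V := EuclideanSpace ℝ (Fin n)) (by norm_num : (0 : ℝ) < 1 / 2)
    have h2 : ∀ x : EuclideanSpace ℝ (Fin n), -‖x‖ ^ 2 / 2 = -(1 / 2) * ‖x‖ ^ 2 := fun x => by ring
    simp_rw [h2]
    rw [h, finrank_euclideanSpace_fin, rpow_neg (by positivity), div_div_eq_mul_div, div_one,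
      mul_comm π 2, inv_mul_cancel₀ (by positivity), ENNReal.ofReal_one]
  · have h := (GaussianFourier.integrable_cexp_neg_mul_sq_norm_add
      (V := EuclideanSpace ℝ (Fin n)) (b := ((1 / 2 : ℝ) : ℂ)) (by norm_num) 0 0).re
    refine (h.congr (Filter.Eventually.of_forall fun x => ?_)).const_mul _
    have : -((1 / 2 : ℝ) : ℂ) * (‖x‖ : ℂ) ^ 2 + 0 * ((inner ℝ 0 x : ℝ) : ℂ) =
      ((-‖x‖ ^ 2 / 2 : ℝ) : ℂ) := by push_cast; ring
    simp only [this]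
    rw [← Complex.ofReal_exp]
    rfl
  · exact Filter.Eventually.of_forall fun x => by positivity

theorem charFun_mul_conj_eq_integral_prod {E : Type*} [NormedAddCommGroup E]
    [InnerProductSpace ℝ E] [MeasurableSpace E] (Q : Measure E) [IsProbabilityMeasure Q] (v : E) :
    charFun Q v * (starRingEnd ℂ) (charFun Q v) =
      ∫ p : E × E, Complex.exp ((inner ℝ (p.1 - p.2) v : ℝ) * Complex.I) ∂(Q.prod Q) := by
  rw [charFun_apply, ← integral_conj, ← integral_prod_mul]
  refine integral_congr_ae (Filter.Eventually.of_forall fun p => ?_)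
  simp only
  rw [← Complex.exp_conj, ← Complex.exp_add, inner_sub_left]
  congr 1
  simp
  ring

theorem integrable_of_continuous_of_norm_le_one {E F : Type*} [TopologicalSpace E]
    [MeasurableSpace E] [BorelSpace E] [NormedAddCommGroup F] [SecondCountableTopology F]
    {μ : Measure E} [IsFiniteMeasure μ] {f : E → F} (hf : Continuous f) (h : ∀ x, ‖f x‖ ≤ 1) :
    Integrable f μ :=
  Integrable.of_bound (by borelize F; exact hf.measurable.aestronglyMeasurable) 1
    (Filter.Eventually.of_forall h)

/-- Expand the square, write φ_Q times its conjugate as a mean over two independent copies, and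
integrate over x first. The result involves Q only through the lengths of y and of differences. -/
theorem integral_norm_charFun_sub_exp_sq {n : ℕ} (Q : Measure (EuclideanSpace ℝ (Fin n)))
    [IsProbabilityMeasure Q] (c : ℝ) :
    ∫ x, ‖charFun Q (c • x) - (exp (-(‖c • x‖ ^ 2 / 2)) : ℝ)‖ ^ 2 ∂(stdGaussMeasure n) =
      ∫ p, exp (-(c ^ 2 * ‖p.1 - p.2‖ ^ 2 / 2)) ∂(Q.prod Q)
      - 2 * ∫ y, (1 + c ^ 2) ^ (-(n / 2 : ℝ)) * exp (-(c ^ 2 * ‖y‖ ^ 2 / (2 * (1 + c ^ 2)))) ∂Q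
      + (1 + 2 * c ^ 2) ^ (-(n / 2 : ℝ)) := by
  have hexp : ∀ x : EuclideanSpace ℝ (Fin n), ‖((exp (-(‖c • x‖ ^ 2 / 2)) : ℝ) : ℂ)‖ ≤ 1 := by
    intro x
    rw [Complex.norm_real, norm_of_nonneg (exp_pos _).le]
    exact exp_le_one_iff.2 (by have := sq_nonneg ‖c • x‖; linarith)
  have hexpc : Continuous fun x : EuclideanSpace ℝ (Fin n) =>
      ((exp (-(‖c • x‖ ^ 2 / 2)) : ℝ) : ℂ) := by fun_prop
  have hI : ∀ (r : ℝ), ‖Complex.exp (r * Complex.I)‖ ≤ 1 := fun r => by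
    rw [Complex.norm_exp_ofReal_mul_I]
  have hff : Integrable (fun x => charFun Q (c • x) * (starRingEnd ℂ) (charFun Q (c • x)))
      (stdGaussMeasure n) := by
    refine integrable_of_continuous_of_norm_le_one ?_ fun x => ?_
    · have : Continuous (charFun Q) := by fun_prop
      fun_prop
    · rw [norm_mul, RCLike.norm_conj]
      have := norm_charFun_le_one (μ := Q) (c • x)
      exact mul_le_one₀ this (norm_nonneg _) this
  have hfg : Integrable (fun x => charFun Q (c • x) * ((exp (-(‖c • x‖ ^ 2 / 2)) : ℝ) : ℂ))
      (stdGaussMeasure n) := by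
    refine integrable_of_continuous_of_norm_le_one ?_ fun x => ?_
    · have : Continuous (charFun Q) := by fun_prop
      fun_prop
    · rw [norm_mul]
      exact mul_le_one₀ (norm_charFun_le_one _) (norm_nonneg _) (hexp x)
  have hgg : Integrable (fun x : EuclideanSpace ℝ (Fin n) =>
      ((exp (-(‖c • x‖ ^ 2 / 2)) : ℝ) : ℂ) ^ 2) (stdGaussMeasure n) := by
    refine integrable_of_continuous_of_norm_le_one (by fun_prop) fun x => ?_
    rw [norm_pow]
    exact pow_le_one₀ (norm_nonneg _) (hexp x)
  have e1 : ∫ x, charFun Q (c • x) * (starRingEnd ℂ) (charFun Q (c • x)) ∂(stdGaussMeasure n) =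
      ((∫ p, exp (-(c ^ 2 * ‖p.1 - p.2‖ ^ 2 / 2)) ∂(Q.prod Q) : ℝ) : ℂ) := by
    simp_rw [charFun_mul_conj_eq_integral_prod]
    rw [integral_integral_swap, ← integral_complex_ofReal]
    · refine integral_congr_ae (Filter.Eventually.of_forall fun p => ?_)
      have := integral_cexp_inner_mul_exp_stdGaussMeasure (c • (p.1 - p.2)) le_rfl
      simp only [zero_mul, zero_div, neg_zero, exp_zero, Complex.ofReal_one, mul_one,
        add_zero, one_rpow, one_mul] at this
      simp only [inner_smul_right, ← real_inner_smul_left]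
      rw [this, norm_smul, mul_pow, norm_eq_abs, sq_abs]
    · refine integrable_of_continuous_of_norm_le_one ?_ fun x => hI _
      simp only [Function.uncurry_def]
      fun_prop
  have e2 : ∫ x, charFun Q (c • x) * ((exp (-(‖c • x‖ ^ 2 / 2)) : ℝ) : ℂ) ∂(stdGaussMeasure n) =
      ((∫ y, (1 + c ^ 2) ^ (-(n / 2 : ℝ)) * exp (-(c ^ 2 * ‖y‖ ^ 2 / (2 * (1 + c ^ 2)))) ∂Q : ℝ)
        : ℂ) := by
    simp_rw [charFun_apply, ← integral_mul_const]
    rw [integral_integral_swap, ← integral_complex_ofReal]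
    · refine integral_congr_ae (Filter.Eventually.of_forall fun y => ?_)
      have := integral_cexp_inner_mul_exp_stdGaussMeasure (c • y) (sq_nonneg c)
      simp only [inner_smul_right, ← real_inner_smul_left]
      simp only [norm_smul, mul_pow, norm_eq_abs, sq_abs] at this ⊢
      exact this
    · refine integrable_of_continuous_of_norm_le_one ?_ fun x => ?_
      · simp only [Function.uncurry_def]
        fun_prop
      · simp only [Function.uncurry_def]
        rw [norm_mul]
        exact mul_le_one₀ (hI _) (norm_nonneg _) (hexp _)
  have e3 : ∫ x : EuclideanSpace ℝ (Fin n), ((exp (-(‖c • x‖ ^ 2 / 2)) : ℝ) : ℂ) ^ 2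
      ∂(stdGaussMeasure n) = (((1 + 2 * c ^ 2) ^ (-(n / 2 : ℝ)) : ℝ) : ℂ) := by
    have := integral_cexp_inner_mul_exp_stdGaussMeasure (0 : EuclideanSpace ℝ (Fin n))
      (by positivity : 0 ≤ 2 * c ^ 2)
    simp only [inner_zero_left, Complex.ofReal_zero, zero_mul, Complex.exp_zero, one_mul,
      norm_zero, ne_eq, OfNat.ofNat_ne_zero, not_false_eq_true, zero_pow, zero_div, neg_zero,
      exp_zero, mul_one] at this
    rw [← this]
    refine integral_congr_ae (Filter.Eventually.of_forall fun x => ?_)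
    simp only
    rw [← Complex.ofReal_pow, ← exp_nat_mul, norm_smul, mul_pow, norm_eq_abs, sq_abs]
    congr 2
    push_cast
    ring
  rw [← Complex.ofReal_inj, ← integral_complex_ofReal]
  have hpt : ∀ x, ((‖charFun Q (c • x) - (exp (-(‖c • x‖ ^ 2 / 2)) : ℝ)‖ ^ 2 : ℝ) : ℂ) =
      charFun Q (c • x) * (starRingEnd ℂ) (charFun Q (c • x))
      - charFun Q (c • x) * ((exp (-(‖c • x‖ ^ 2 / 2)) : ℝ) : ℂ)
      - (starRingEnd ℂ) (charFun Q (c • x) * ((exp (-(‖c • x‖ ^ 2 / 2)) : ℝ) : ℂ))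
      + ((exp (-(‖c • x‖ ^ 2 / 2)) : ℝ) : ℂ) ^ 2 := by
    intro x
    rw [Complex.ofReal_pow, ← Complex.mul_conj', map_sub, map_mul, Complex.conj_ofReal]
    ring
  simp_rw [hpt]
  have hfgc : Integrable (fun x => (starRingEnd ℂ) (charFun Q (c • x) *
      ((exp (-(‖c • x‖ ^ 2 / 2)) : ℝ) : ℂ))) (stdGaussMeasure n) :=
    (LinearIsometryEquiv.integrable_comp_iff Complex.conjLIE).2 hfg
  rw [integral_add, integral_sub, integral_sub hff hfg, integral_conj, e1, e2, e3,
    Complex.conj_ofReal]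
  · push_cast
    ring
  · exact hff.sub hfg
  · exact hfgc
  · exact (hff.sub hfg).sub hfgc
  · exact hgg

/-! ### Fourier analysis of differences of distribution functions -/

/-- The difference of the distribution functions of the Dirac masses at `u` and at `0`. -/
noncomputable def stepDiff (u y : ℝ) : ℝ := (if u ≤ y then 1 else 0) - (if 0 ≤ y then 1 else 0)

theorem measurable_stepDiff : Measurable (Function.uncurry stepDiff) := by
  unfold stepDiff Function.uncurry
  refine Measurable.sub ?_ ?_
  · exact Measurable.ite (measurableSet_le measurable_fst measurable_snd) measurable_const
      measurable_const
  · exact Measurable.ite (measurableSet_le measurable_const measurable_snd) measurable_const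
      measurable_const

theorem stepDiff_of_nonpos {u : ℝ} (hu : u ≤ 0) : stepDiff u = (Ico u 0).indicator 1 := by
  ext y
  simp only [stepDiff, indicator, mem_Ico, Pi.one_apply]
  split_ifs <;> first | (norm_num; done) | (exfalso; grind)

theorem stepDiff_of_nonneg {u : ℝ} (hu : 0 ≤ u) : stepDiff u = -(Ico 0 u).indicator 1 := by
  ext y
  simp only [stepDiff, indicator, mem_Ico, Pi.one_apply, Pi.neg_apply]
  split_ifs <;> first | (norm_num; done) | (exfalso; grind)

theorem integral_stepDiff_mul (u : ℝ) (g : ℝ → ℂ) :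
    ∫ y, (stepDiff u y : ℂ) * g y = ∫ y in u..0, g y := by
  have key : ∀ a b : ℝ, ∫ y, (((Ico a b).indicator (1 : ℝ → ℝ) y : ℝ) : ℂ) * g y =
      ∫ y in Ioc a b, g y := by
    intro a b
    rw [← integral_Ico_eq_integral_Ioc, ← integral_indicator measurableSet_Ico]
    refine integral_congr_ae (Filter.Eventually.of_forall fun y => ?_)
    by_cases h : y ∈ Ico a b <;> simp [h]
  rcases le_total u 0 with hu | hu
  · rw [stepDiff_of_nonpos hu, key, intervalIntegral.integral_of_le hu]
  · rw [stepDiff_of_nonneg hu, intervalIntegral.integral_of_ge hu, ← key, ← integral_neg]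
    refine integral_congr_ae (Filter.Eventually.of_forall fun y => ?_)
    simp

theorem integrable_stepDiff (u : ℝ) : Integrable (stepDiff u) := by
  rcases le_total u 0 with hu | hu
  · rw [stepDiff_of_nonpos hu]
    exact (integrable_indicator_iff measurableSet_Ico).2
      (continuous_const.integrableOn_Icc.mono_set Ico_subset_Icc_self)
  · rw [stepDiff_of_nonneg hu]
    exact ((integrable_indicator_iff measurableSet_Ico).2
      (continuous_const.integrableOn_Icc.mono_set Ico_subset_Icc_self)).neg

theorem integral_norm_stepDiff (u : ℝ) : ∫ y, ‖stepDiff u y‖ = |u| := by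
  rcases le_total u 0 with hu | hu
  · rw [stepDiff_of_nonpos hu, abs_of_nonpos hu]
    simp only [norm_indicator_eq_indicator_norm]
    rw [integral_indicator measurableSet_Ico]
    simp [hu]
  · rw [stepDiff_of_nonneg hu, abs_of_nonneg hu]
    simp only [Pi.neg_apply, norm_neg, norm_indicator_eq_indicator_norm]
    rw [integral_indicator measurableSet_Ico]
    simp [hu]

/-- A distribution function is not integrable, but its difference from the unit step at 0 is a
mixture of the functions `stepDiff u`, whose L¹-norms are |u|; a finite first moment is therefore
what Fubini requires. -/
theorem integrable_stepDiff_prod {μ : Measure ℝ} [IsProbabilityMeasure μ]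
    (hμ : Integrable (fun x => x) μ) :
    Integrable (Function.uncurry stepDiff) (μ.prod volume) := by
  rw [integrable_prod_iff measurable_stepDiff.aestronglyMeasurable]
  refine ⟨Filter.Eventually.of_forall fun u => integrable_stepDiff u, ?_⟩
  simp only [Function.uncurry, integral_norm_stepDiff]
  exact hμ.abs

theorem integral_stepDiff_eq_cdf_sub {μ : Measure ℝ} [IsProbabilityMeasure μ] (y : ℝ) :
    ∫ u, stepDiff u y ∂μ = cdf μ y - (if 0 ≤ y then 1 else 0) := by
  unfold stepDiff
  have h1 : ∀ u : ℝ, (if u ≤ y then (1 : ℝ) else 0) = (Iic y).indicator 1 u := fun u => by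
    simp [indicator]
  simp_rw [h1]
  rw [integral_sub ((integrable_indicator_iff measurableSet_Iic).2 (integrable_const _).integrableOn)
    (integrable_const _), integral_indicator_one measurableSet_Iic, cdf_eq_real]
  simp

theorem integrable_cdf_sub_step {μ : Measure ℝ} [IsProbabilityMeasure μ]
    (hμ : Integrable (fun x => x) μ) :
    Integrable (fun y => cdf μ y - (if 0 ≤ y then 1 else 0)) := by
  simp_rw [← integral_stepDiff_eq_cdf_sub]
  exact (integrable_stepDiff_prod hμ).integral_prod_right

theorem integrable_cdf_sub_cdf {μ ν : Measure ℝ} [IsProbabilityMeasure μ] [IsProbabilityMeasure ν]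
    (hμ : Integrable (fun x => x) μ) (hν : Integrable (fun x => x) ν) :
    Integrable (fun y => cdf μ y - cdf ν y) := by
  refine ((integrable_cdf_sub_step hμ).sub (integrable_cdf_sub_step hν)).congr
    (Filter.Eventually.of_forall fun y => ?_)
  simp

/-- The Fourier transform `s ↦ ∫ h(y) exp(-isy) dy` of a real function. -/
noncomputable def fourierExp (h : ℝ → ℝ) (s : ℝ) : ℂ :=
  ∫ y, (h y : ℂ) * Complex.exp (-(s * y : ℝ) * Complex.I)

theorem norm_cexp_neg_mul_I (r : ℝ) : ‖Complex.exp (-(r : ℂ) * Complex.I)‖ = 1 := by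
  rw [← Complex.ofReal_neg, Complex.norm_exp_ofReal_mul_I]

theorem integrable_mul_cexp {h : ℝ → ℝ} (hh : Integrable h) (s : ℝ) :
    Integrable (fun y => (h y : ℂ) * Complex.exp (-(s * y : ℝ) * Complex.I)) :=
  hh.ofReal.mul_bdd (c := 1) (by fun_prop)
    (Filter.Eventually.of_forall fun y => (norm_cexp_neg_mul_I _).le)

theorem norm_fourierExp_le (h : ℝ → ℝ) (s : ℝ) : ‖fourierExp h s‖ ≤ ∫ y, ‖h y‖ := by
  refine (norm_integral_le_integral_norm _).trans (le_of_eq ?_)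
  refine integral_congr_ae (Filter.Eventually.of_forall fun y => ?_)
  simp only
  rw [norm_mul, norm_cexp_neg_mul_I, mul_one, Complex.norm_real]

theorem continuous_fourierExp {h : ℝ → ℝ} (hh : Integrable h) : Continuous (fourierExp h) := by
  refine continuous_of_dominated (bound := fun y => ‖h y‖)
    (fun s => (integrable_mul_cexp hh s).aestronglyMeasurable) (fun s => ?_) hh.norm ?_
  · refine Filter.Eventually.of_forall fun y => ?_
    rw [norm_mul, norm_cexp_neg_mul_I, mul_one, Complex.norm_real]
  · exact Filter.Eventually.of_forall fun y => by fun_prop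

/-- Fubini replaces integration by parts: the transform of `stepDiff u` is (exp(-isu) - 1)/(is), and
this is averaged over u. -/
theorem fourierExp_cdf_sub_step {μ : Measure ℝ} [IsProbabilityMeasure μ]
    (hμ : Integrable (fun x => x) μ) {s : ℝ} (hs : s ≠ 0) :
    fourierExp (fun y => cdf μ y - (if 0 ≤ y then 1 else 0)) s =
      (charFun μ (-s) - 1) / (s * Complex.I) := by
  have hsI : (s : ℂ) * Complex.I ≠ 0 := by simp [hs]
  unfold fourierExp
  simp_rw [← integral_stepDiff_eq_cdf_sub, ← integral_complex_ofReal, ← integral_mul_const]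
  rw [integral_integral_swap]
  · have h1 : ∀ u : ℝ, ∫ y, (stepDiff u y : ℂ) * Complex.exp (-(s * y : ℝ) * Complex.I) =
        (Complex.exp (-(s * u : ℝ) * Complex.I) - 1) / (s * Complex.I) := by
      intro u
      rw [integral_stepDiff_mul]
      have h2 : ∀ y : ℝ, Complex.exp (-(s * y : ℝ) * Complex.I) =
          Complex.exp (-(s * Complex.I) * y) := fun y => by congr 1; push_cast; ring
      simp_rw [h2]
      rw [integral_exp_mul_complex (neg_ne_zero.2 hsI), div_neg, ← neg_div]
      simp
    simp_rw [h1]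
    rw [integral_div, integral_sub, charFun_apply_real]
    · simp [mul_comm]
    · refine integrable_of_continuous_of_norm_le_one (by fun_prop) fun u =>
        (norm_cexp_neg_mul_I _).le
    · exact integrable_const _
  · have := (integrable_stepDiff_prod hμ).swap.ofReal (𝕜 := ℂ)
    exact this.mul_bdd (c := 1) (by fun_prop)
      (Filter.Eventually.of_forall fun p => (norm_cexp_neg_mul_I _).le)

theorem norm_fourierExp_cdf_sub_cdf {μ ν : Measure ℝ} [IsProbabilityMeasure μ]
    [IsProbabilityMeasure ν] (hμ : Integrable (fun x => x) μ) (hν : Integrable (fun x => x) ν)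
    {s : ℝ} (hs : s ≠ 0) :
    ‖fourierExp (fun y => cdf μ y - cdf ν y) s‖ = ‖charFun μ s - charFun ν s‖ / |s| := by
  have h : fourierExp (fun y => cdf μ y - cdf ν y) s =
      fourierExp (fun y => cdf μ y - (if 0 ≤ y then 1 else 0)) s -
      fourierExp (fun y => cdf ν y - (if 0 ≤ y then 1 else 0)) s := by
    unfold fourierExp
    rw [← integral_sub (integrable_mul_cexp (integrable_cdf_sub_step hμ) s)
      (integrable_mul_cexp (integrable_cdf_sub_step hν) s)]
    refine integral_congr_ae (Filter.Eventually.of_forall fun y => ?_)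
    simp only
    push_cast
    ring
  rw [h, fourierExp_cdf_sub_step hμ hs, fourierExp_cdf_sub_step hν hs, ← sub_div,
    sub_sub_sub_cancel_right, charFun_neg, charFun_neg, ← map_sub, norm_div, RCLike.norm_conj]
  simp

theorem gaussianPDFReal_eq_integral (x : ℝ) {v : NNReal} (hv : v ≠ 0) (y : ℝ) :
    (gaussianPDFReal x v y : ℂ) = (2 * π : ℝ)⁻¹ *
      ∫ s : ℝ, (exp (-(v * s ^ 2 / 2)) : ℝ) * Complex.exp ((s * (x - y) : ℝ) * Complex.I) := by
  have hv0 : (0 : ℝ) < v := by exact_mod_cast pos_iff_ne_zero.2 hv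
  have hb : 0 < (((v / 2 : ℝ)) : ℂ).re := by rw [Complex.ofReal_re]; positivity
  have h := fourierIntegral_gaussian hb ((x - y : ℝ) : ℂ)
  have h1 : ∀ s : ℝ, ((exp (-(v * s ^ 2 / 2)) : ℝ) : ℂ) *
      Complex.exp ((s * (x - y) : ℝ) * Complex.I) =
      Complex.exp (Complex.I * ((x - y : ℝ) : ℂ) * s) *
        Complex.exp (-((v / 2 : ℝ) : ℂ) * s ^ 2) := by
    intro s
    rw [Complex.ofReal_exp, ← Complex.exp_add, ← Complex.exp_add]
    congr 1
    push_cast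
    ring
  simp_rw [h1]
  rw [h, gaussianPDFReal]
  have h2 : ((π : ℂ) / ((v / 2 : ℝ) : ℂ)) ^ (1 / 2 : ℂ) = ((√(π / (v / 2)) : ℝ) : ℂ) := by
    rw [sqrt_eq_rpow, Complex.ofReal_cpow (by positivity)]
    push_cast; rfl
  have h3 : Complex.exp (-((x - y : ℝ) : ℂ) ^ 2 / (4 * ((v / 2 : ℝ) : ℂ))) =
      ((exp (-(y - x) ^ 2 / (2 * v)) : ℝ) : ℂ) := by
    rw [Complex.ofReal_exp]
    congr 1
    push_cast
    field_simp
    try ring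
  rw [h2, h3, ← Complex.ofReal_mul, ← Complex.ofReal_mul, ← mul_assoc]
  congr 2
  have h4 : π / (v / 2) = (2 * π) ^ 2 / (2 * π * v) := by field_simp
  rw [h4, sqrt_div (by positivity), sqrt_sq (by positivity)]
  field_simp

/-- Gaussian smoothing in terms of the Fourier transform. -/
theorem integral_gaussianReal_eq_fourierExp {h : ℝ → ℝ} (hh : Integrable h) (x : ℝ) {v : NNReal}
    (hv : v ≠ 0) :
    ((∫ y, h y ∂(gaussianReal x v) : ℝ) : ℂ) = (2 * π : ℝ)⁻¹ *
      ∫ s : ℝ, (exp (-(v * s ^ 2 / 2)) : ℝ) * Complex.exp ((s * x : ℝ) * Complex.I) *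
        fourierExp h s := by
  have hv0 : (0 : ℝ) < v := by exact_mod_cast pos_iff_ne_zero.2 hv
  rw [integral_gaussianReal_eq_integral_smul hv, ← integral_complex_ofReal]
  simp only [smul_eq_mul, Complex.ofReal_mul (gaussianPDFReal _ _ _), gaussianPDFReal_eq_integral x hv]
  simp_rw [mul_assoc (Complex.ofReal (2 * π)⁻¹)]
  rw [integral_const_mul]
  congr 1
  simp_rw [← integral_mul_const]
  rw [integral_integral_swap]
  · refine integral_congr_ae (Filter.Eventually.of_forall fun s => ?_)
    simp only [fourierExp]
    rw [← integral_const_mul]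
    refine integral_congr_ae (Filter.Eventually.of_forall fun y => ?_)
    simp only
    have : Complex.exp ((s * (x - y) : ℝ) * Complex.I) =
        Complex.exp ((s * x : ℝ) * Complex.I) * Complex.exp (-(s * y : ℝ) * Complex.I) := by
      rw [← Complex.exp_add]; congr 1; push_cast; ring
    rw [this]
    ring
  · have hg : Integrable (fun s : ℝ => exp (-(v * s ^ 2 / 2))) := by
      refine (integrable_exp_neg_mul_sq (by positivity : 0 < (v : ℝ) / 2)).congr
        (Filter.Eventually.of_forall fun s => ?_)
      simp only; congr 1; ring
    have h0 : Integrable (fun p : ℝ × ℝ => ((h p.1 * exp (-(v * p.2 ^ 2 / 2)) : ℝ) : ℂ)) :=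
      (hh.mul_prod hg).ofReal
    have h1 := h0.bdd_mul (c := 1)
      (f := fun p : ℝ × ℝ => Complex.exp ((p.2 * (x - p.1) : ℝ) * Complex.I)) (by fun_prop)
      (Filter.Eventually.of_forall fun p => (Complex.norm_exp_ofReal_mul_I _).le)
    refine h1.congr (Filter.Eventually.of_forall fun p => ?_)
    simp only [Function.uncurry]
    push_cast
    ring

theorem abs_integral_gaussianReal_le {h : ℝ → ℝ} (hh : Integrable h) (x : ℝ) {v : NNReal}
    (hv : v ≠ 0) :
    |∫ y, h y ∂(gaussianReal x v)| ≤
      (2 * π)⁻¹ * ∫ s : ℝ, exp (-(v * s ^ 2 / 2)) * ‖fourierExp h s‖ := by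
  rw [← norm_eq_abs, ← Complex.norm_real, integral_gaussianReal_eq_fourierExp hh x hv, norm_mul,
    Complex.norm_real, norm_of_nonneg (by positivity)]
  gcongr
  refine (norm_integral_le_integral_norm _).trans (le_of_eq ?_)
  refine integral_congr_ae (Filter.Eventually.of_forall fun s => ?_)
  simp only
  rw [norm_mul, norm_mul, Complex.norm_exp_ofReal_mul_I, Complex.norm_real,
    norm_of_nonneg (exp_pos _).le, mul_one]

theorem integrable_exp_mul_norm_fourierExp {h : ℝ → ℝ} (hh : Integrable h) {v : ℝ} (hv : 0 < v)
    (k : ℕ) : Integrable (fun s : ℝ => exp (-(v * s ^ 2 / 2)) * ‖fourierExp h s‖ ^ k) := by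
  have hg : Integrable (fun s : ℝ => exp (-(v * s ^ 2 / 2))) := by
    refine (integrable_exp_neg_mul_sq (by positivity : 0 < v / 2)).congr
      (Filter.Eventually.of_forall fun s => ?_)
    simp only; congr 1; ring
  refine hg.mul_bdd (c := (∫ y, ‖h y‖) ^ k)
    ((continuous_fourierExp hh).norm.pow k).aestronglyMeasurable
    (Filter.Eventually.of_forall fun s => ?_)
  rw [norm_pow, norm_norm]
  exact pow_le_pow_left₀ (norm_nonneg _) (norm_fourierExp_le h s) k

/-- Plancherel with a Gaussian cut-off. The extra factor makes the exchange of integrals legitimate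
although `fourierExp h` is only known to be bounded and continuous. -/
theorem integral_mul_integral_gaussianReal {h : ℝ → ℝ} (hh : Integrable h) {v : NNReal}
    (hv : v ≠ 0) :
    ∫ x, h x * ∫ y, h y ∂(gaussianReal x v) =
      (2 * π)⁻¹ * ∫ s : ℝ, exp (-(v * s ^ 2 / 2)) * ‖fourierExp h s‖ ^ 2 := by
  have hv0 : (0 : ℝ) < v := by exact_mod_cast pos_iff_ne_zero.2 hv
  rw [← Complex.ofReal_inj, ← integral_complex_ofReal, Complex.ofReal_mul,
    ← integral_complex_ofReal]
  simp only [Complex.ofReal_mul, integral_gaussianReal_eq_fourierExp hh _ hv]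
  simp_rw [mul_left_comm (Complex.ofReal (h _)) (Complex.ofReal _)]
  rw [integral_const_mul]
  push_cast
  congr 1
  simp_rw [← integral_const_mul]
  rw [integral_integral_swap]
  · refine integral_congr_ae (Filter.Eventually.of_forall fun s => ?_)
    simp only
    rw [← Complex.mul_conj', ← mul_assoc, mul_comm _ ((starRingEnd ℂ) _)]
    have h1 : (starRingEnd ℂ) (fourierExp h s) =
        ∫ x, (h x : ℂ) * Complex.exp ((s * x : ℝ) * Complex.I) := by
      rw [fourierExp, ← integral_conj]
      refine integral_congr_ae (Filter.Eventually.of_forall fun x => ?_)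
      simp only
      rw [map_mul, Complex.conj_ofReal, ← Complex.exp_conj]
      simp
    rw [h1, ← integral_mul_const]
    refine integral_congr_ae (Filter.Eventually.of_forall fun x => ?_)
    simp only
    push_cast
    ring
  · have hg := (integrable_exp_mul_norm_fourierExp hh hv0 1)
    have hg2 : Integrable (fun s : ℝ => ((exp (-(v * s ^ 2 / 2)) : ℝ) : ℂ) * fourierExp h s) := by
      refine hg.mono' ?_ (Filter.Eventually.of_forall fun s => ?_)
      · have := continuous_fourierExp hh
        fun_prop
      · rw [norm_mul, Complex.norm_real, norm_of_nonneg (exp_pos _).le, pow_one]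
    have h0 : Integrable (fun y => (h y : ℂ)) := hh.ofReal
    have h1 := (h0.mul_prod hg2).bdd_mul (c := 1)
      (f := fun p : ℝ × ℝ => Complex.exp ((p.2 * p.1 : ℝ) * Complex.I)) (by fun_prop)
      (Filter.Eventually.of_forall fun p => (Complex.norm_exp_ofReal_mul_I _).le)
    refine h1.congr (Filter.Eventually.of_forall fun p => ?_)
    simp only [Function.uncurry]
    push_cast
    ring

open Filter Topology in
/-- Plancherel's inequality for bounded, integrable, almost everywhere continuous functions. -/
theorem ofReal_integral_sq_le_lintegral_fourierExp {h : ℝ → ℝ} (hm : Measurable h)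
    (hh : Integrable h) {B : ℝ} (hB : ∀ x, |h x| ≤ B) (hc : ∀ᵐ x, ContinuousAt h x) :
    ENNReal.ofReal (∫ x, h x ^ 2) ≤
      ∫⁻ s, ENNReal.ofReal ((2 * π)⁻¹ * ‖fourierExp h s‖ ^ 2) := by
  set σ : ℕ → ℝ := fun k => 1 / ((k : ℝ) + 1) with hσdef
  have hσ : ∀ k, 0 < σ k := fun k => by simp only [hσdef]; positivity
  have hσ0 : Tendsto σ atTop (𝓝 0) := tendsto_one_div_add_atTop_nhds_zero_nat
  -- Rescaling moves the shrinking variance into the argument of h, so that dominated convergence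
  -- applies under one fixed measure and gives h x at every continuity point.
  have hS : ∀ k x, ∫ y, h y ∂(gaussianReal x (NNReal.mk (σ k ^ 2) (sq_nonneg _))) =
      ∫ y, h (x + σ k * y) ∂(gaussianReal 0 1) := by
    intro k x
    have h1 : gaussianReal x (NNReal.mk (σ k ^ 2) (sq_nonneg _)) =
        (gaussianReal 0 1).map (fun y => x + σ k * y) := by
      have : (fun y => x + σ k * y) = (fun y => x + y) ∘ (fun y => σ k * y) := rfl
      rw [this, ← Measure.map_map (by fun_prop) (by fun_prop), gaussianReal_map_const_mul,
        gaussianReal_map_const_add]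
      simp
    rw [h1, integral_map (by fun_prop) hm.aestronglyMeasurable]
  have hbd : ∀ k x, |∫ y, h (x + σ k * y) ∂(gaussianReal 0 1)| ≤ B := by
    intro k x
    have h1 := norm_integral_le_of_norm_le_const (μ := gaussianReal 0 1)
      (f := fun y => h (x + σ k * y)) (C := B) (Eventually.of_forall fun y => hB _)
    simpa using h1
  have hmeas : ∀ k, Measurable fun x => ∫ y, h (x + σ k * y) ∂(gaussianReal 0 1) := by
    intro k
    refine StronglyMeasurable.measurable (StronglyMeasurable.integral_prod_right ?_)
    exact (hm.comp (by fun_prop)).stronglyMeasurable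
  have hlim : Tendsto (fun k => ∫ x, h x * ∫ y, h (x + σ k * y) ∂(gaussianReal 0 1)) atTop
      (𝓝 (∫ x, h x ^ 2)) := by
    refine tendsto_integral_of_dominated_convergence (fun x => |h x| * B)
      (fun k => (hm.mul (hmeas k)).aestronglyMeasurable) (hh.abs.mul_const B)
      (fun k => Eventually.of_forall fun x => ?_) ?_
    · rw [norm_mul, norm_eq_abs, norm_eq_abs]
      exact mul_le_mul_of_nonneg_left (hbd k x) (abs_nonneg _)
    · filter_upwards [hc] with x hx
      rw [sq]
      refine Tendsto.const_mul _ ?_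
      have h1 : Tendsto (fun k => ∫ y, h (x + σ k * y) ∂(gaussianReal 0 1)) atTop
          (𝓝 (∫ _, h x ∂(gaussianReal 0 1))) := by
        refine tendsto_integral_of_dominated_convergence (fun _ => B)
          (fun k => (hm.comp (by fun_prop)).aestronglyMeasurable) (integrable_const _)
          (fun k => Eventually.of_forall fun y => hB _) (Eventually.of_forall fun y => ?_)
        have h2 : Tendsto (fun k => x + σ k * y) atTop (𝓝 x) := by
          simpa using (hσ0.mul_const y).const_add x
        exact hx.tendsto.comp h2
      simpa using h1
  refine le_of_tendsto ((ENNReal.continuous_ofReal.tendsto _).comp hlim)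
    (Eventually.of_forall fun k => ?_)
  have hv : NNReal.mk (σ k ^ 2) (sq_nonneg _) ≠ 0 := by
    rw [ne_eq, ← NNReal.coe_eq_zero]
    exact (pow_pos (hσ k) 2).ne'
  have h3 := integral_mul_integral_gaussianReal hh hv
  simp only [hS] at h3
  simp only [Function.comp]
  rw [h3, ← integral_const_mul, ofReal_integral_eq_lintegral_ofReal]
  · refine lintegral_mono fun s => ENNReal.ofReal_le_ofReal ?_
    gcongr
    refine mul_le_of_le_one_left (by positivity) (exp_le_one_iff.2 ?_)
    rw [neg_nonpos]
    positivity
  · refine Integrable.const_mul ?_ _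
    exact integrable_exp_mul_norm_fourierExp hh (v := σ k ^ 2) (pow_pos (hσ k) 2) 2
  · exact Eventually.of_forall fun s => by positivity

/-! ### Smoothing inequality for the uniform distance -/

theorem integrable_id_gaussianReal (m : ℝ) (v : NNReal) :
    Integrable (fun x => x) (gaussianReal m v) :=
  memLp_one_iff_integrable.1 (memLp_id_gaussianReal 1)

theorem integral_sub_sq_gaussianReal (m : ℝ) (v : NNReal) :
    Integrable (fun y => (y - m) ^ 2) (gaussianReal m v) ∧
    ∫ y, (y - m) ^ 2 ∂(gaussianReal m v) = v := by
  have h2 : MemLp (fun y : ℝ => y) 2 (gaussianReal m v) := memLp_id_gaussianReal 2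
  refine ⟨(h2.sub (memLp_const m)).integrable_sq, ?_⟩
  have h := variance_fun_id_gaussianReal (μ := m) (v := v)
  rw [variance_eq_integral (by fun_prop), integral_id_gaussianReal] at h
  exact h

/-- Gaussian smoothing inequality, one-sided form. -/
theorem sub_le_integral_gaussianReal {h : ℝ → ℝ} {m : ℝ} {v : NNReal} {σ d e R : ℝ} (hσ : 0 < σ)
    (hv : (v : ℝ) = σ ^ 2) (hm : Measurable h) (hR : ∀ y, |h y| ≤ R) (hd : -R ≤ d)
    (hde : ∀ y, |y - m| ≤ 2 * σ → d - e ≤ h y) (he : 0 ≤ e) :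
    d - e - (d + R) / 4 ≤ ∫ y, h y ∂(gaussianReal m v) := by
  obtain ⟨i1, i2⟩ := integral_sub_sq_gaussianReal m v
  have hint : Integrable h (gaussianReal m v) :=
    Integrable.of_bound hm.aestronglyMeasurable R (Filter.Eventually.of_forall hR)
  -- A parabola lies below h: within 2σ of m it is at most d - e, and farther out it has dropped
  -- below -R. Its Gaussian mean needs only the variance, as in Chebyshev's inequality.
  have hle : ∫ y, ((d - e) - (d + R) / (4 * σ ^ 2) * (y - m) ^ 2) ∂(gaussianReal m v) ≤
      ∫ y, h y ∂(gaussianReal m v) := by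
    refine integral_mono ((integrable_const _).sub (i1.const_mul _)) hint fun y => ?_
    simp only
    have hdR : 0 ≤ d + R := by linarith
    rcases le_total |y - m| (2 * σ) with h1 | h1
    · have : 0 ≤ (d + R) / (4 * σ ^ 2) * (y - m) ^ 2 := by positivity
      linarith [hde y h1]
    · have h2 : 4 * σ ^ 2 ≤ (y - m) ^ 2 := by
        rw [← sq_abs (y - m)]; nlinarith
      have h3 : d + R ≤ (d + R) / (4 * σ ^ 2) * (y - m) ^ 2 := by
        rw [div_mul_eq_mul_div, le_div_iff₀ (by positivity)]
        gcongr
      linarith [(abs_le.1 (hR y)).1]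
  rw [integral_sub (integrable_const _) (i1.const_mul _), integral_const_mul, i2, hv] at hle
  simp only [integral_const, probReal_univ, smul_eq_mul, one_mul] at hle
  have : (d + R) / (4 * σ ^ 2) * σ ^ 2 = (d + R) / 4 := by field_simp
  linarith

/-- Gaussian smoothing inequality for the distance between a monotone function and a monotone
Lipschitz function with values in `[0, 1]`. -/
theorem abs_sub_le_of_gaussian_smoothing {F G : ℝ → ℝ} (hF : Monotone F) (hG : Monotone G)
    (hF0 : ∀ x, 0 ≤ F x) (hF1 : ∀ x, F x ≤ 1) (hG0 : ∀ x, 0 ≤ G x) (hG1 : ∀ x, G x ≤ 1)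
    (hL : ∀ x y, x ≤ y → G y - G x ≤ y - x) {σ δ : ℝ} (hσ : 0 < σ) {v : NNReal}
    (hv : (v : ℝ) = σ ^ 2) (hδ : ∀ x, |∫ y, (F y - G y) ∂(gaussianReal x v)| ≤ δ) (x : ℝ) :
    |F x - G x| ≤ 2 * δ + 8 * σ := by
  have hbdd : BddAbove (range fun x => |F x - G x|) := by
    refine ⟨1, ?_⟩
    rintro _ ⟨y, rfl⟩
    exact abs_le.2 ⟨by linarith [hF0 y, hG1 y], by linarith [hF1 y, hG0 y]⟩
  set R := ⨆ x, |F x - G x| with hRdef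
  have hR : ∀ y, |F y - G y| ≤ R := fun y => le_ciSup hbdd y
  have hR0 : 0 ≤ R := (abs_nonneg _).trans (hR 0)
  have hmeas : Measurable fun y => F y - G y := hF.measurable.sub hG.measurable
  -- The smoothing kernel is centred 2σ to the right of y when F exceeds G there, to the left
  -- otherwise. On the window of length 4σ monotonicity of F then preserves the gap, up to the
  -- variation 4σ of G.
  have key : ∀ y, |F y - G y| ≤ (4 / 3) * (δ + 4 * σ + R / 4) := by
    intro y
    rcases le_total 0 (F y - G y) with h0 | h0
    · rw [abs_of_nonneg h0]
      have h1 := sub_le_integral_gaussianReal (h := fun z => F z - G z) (m := y + 2 * σ)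
        (d := F y - G y) (e := 4 * σ) hσ hv hmeas hR (by linarith) (fun z hz => by
          obtain ⟨hz1, hz2⟩ := abs_le.1 hz
          have hyz : y ≤ z := by linarith
          have := hF hyz
          have := hL y z hyz
          linarith) (by positivity)
      have h2 := (abs_le.1 (hδ (y + 2 * σ))).2
      linarith
    · rw [abs_of_nonpos h0]
      have h1 := sub_le_integral_gaussianReal (h := fun z => G z - F z) (m := y - 2 * σ)
        (R := R) (d := G y - F y) (e := 4 * σ) hσ hv (hG.measurable.sub hF.measurable)
        (fun z => by rw [abs_sub_comm]; exact hR z) (by linarith) (fun z hz => by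
          obtain ⟨hz1, hz2⟩ := abs_le.1 hz
          have hyz : z ≤ y := by linarith
          have := hF hyz
          have := hL z y hyz
          linarith) (by positivity)
      have h2 := (abs_le.1 (hδ (y - 2 * σ))).1
      have h3 : ∫ z, (G z - F z) ∂(gaussianReal (y - 2 * σ) v) =
          -∫ z, (F z - G z) ∂(gaussianReal (y - 2 * σ) v) := by
        rw [← integral_neg]; simp
      linarith
  -- The supremum R occurs on both sides, on the right with coefficient 1/3; solving gives R ≤ 2δ +
  -- 8σ.
  have hRle : R ≤ (4 / 3) * (δ + 4 * σ + R / 4) := ciSup_le key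
  linarith [hR x]

/-! ### Comparison of a law with the standard normal law -/

theorem gaussianReal_zero_one_le_volume (s : Set ℝ) : gaussianReal 0 1 s ≤ volume s := by
  rw [gaussianReal_apply 0 one_ne_zero]
  calc ∫⁻ x in s, gaussianPDF 0 1 x ≤ ∫⁻ _ in s, 1 := by
        refine lintegral_mono fun x => ?_
        rw [gaussianPDF, ENNReal.ofReal_le_one, gaussianPDFReal]
        have h1 : (1 : ℝ) ≤ √(2 * π * (1 : NNReal)) := by
          rw [one_le_sqrt]
          have := pi_gt_three
          push_cast
          linarith
        have h2 : exp (-(x - 0) ^ 2 / (2 * (1 : NNReal))) ≤ 1 := by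
          rw [exp_le_one_iff]
          have := sq_nonneg (x - 0)
          push_cast
          linarith
        exact mul_le_one₀ (inv_le_one_of_one_le₀ h1) (exp_pos _).le h2
    _ = volume s := by simp

theorem stdNormalCDF_sub_le {x y : ℝ} (hxy : x ≤ y) :
    stdNormalCDF y - stdNormalCDF x ≤ y - x := by
  unfold stdNormalCDF
  rw [cdf_eq_real, cdf_eq_real, ← measureReal_sdiff (Iic_subset_Iic.2 hxy) measurableSet_Iic]
  have : Iic y \ Iic x = Ioc x y := by
    ext z; simp [and_comm]
  rw [this]
  refine ENNReal.toReal_le_of_le_ofReal (by linarith) ?_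
  exact (gaussianReal_zero_one_le_volume _).trans (by simp)

theorem continuous_stdNormalCDF : Continuous stdNormalCDF := by
  refine (LipschitzWith.of_dist_le_mul (K := 1) fun x y => ?_).continuous
  rw [dist_eq, dist_eq, NNReal.coe_one, one_mul]
  have hmono : Monotone stdNormalCDF := monotone_cdf _
  rcases le_total x y with h | h
  · rw [abs_sub_comm, abs_of_nonneg (sub_nonneg.2 (hmono h)), abs_sub_comm x,
      abs_of_nonneg (sub_nonneg.2 h)]
    exact stdNormalCDF_sub_le h
  · rw [abs_of_nonneg (sub_nonneg.2 (hmono h)), abs_of_nonneg (sub_nonneg.2 h)]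
    exact stdNormalCDF_sub_le h

theorem charFun_stdNormal (s : ℝ) :
    charFun (gaussianReal 0 1) s = ((exp (-(s ^ 2 / 2)) : ℝ) : ℂ) := by
  rw [charFun_gaussianReal]
  push_cast
  congr 1
  simp

theorem abs_sub_le_one_of_nonneg_of_le_one {a b : ℝ} (ha : 0 ≤ a) (ha1 : a ≤ 1) (hb : 0 ≤ b)
    (hb1 : b ≤ 1) : |a - b| ≤ 1 :=
  abs_le.2 ⟨by linarith, by linarith⟩

theorem abs_cdf_sub_stdNormalCDF_le_one (μ : Measure ℝ) (x : ℝ) :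
    |cdf μ x - stdNormalCDF x| ≤ 1 :=
  abs_sub_le_one_of_nonneg_of_le_one (cdf_nonneg _ _) (cdf_le_one _ _) (cdf_nonneg _ _)
    (cdf_le_one _ _)

theorem integrable_cdf_sub_stdNormalCDF {μ : Measure ℝ} [IsProbabilityMeasure μ]
    (hμ : Integrable (fun x => x) μ) : Integrable fun x => cdf μ x - stdNormalCDF x :=
  integrable_cdf_sub_cdf hμ (integrable_id_gaussianReal 0 1)

theorem integrable_cdf_sub_stdNormalCDF_sq {μ : Measure ℝ} [IsProbabilityMeasure μ]
    (hμ : Integrable (fun x => x) μ) : Integrable fun x => (cdf μ x - stdNormalCDF x) ^ 2 := by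
  have h := integrable_cdf_sub_stdNormalCDF hμ
  refine (h.mul_bdd (c := 1) h.aestronglyMeasurable
    (Filter.Eventually.of_forall (abs_cdf_sub_stdNormalCDF_le_one μ))).congr
    (Filter.Eventually.of_forall fun x => ?_)
  simp only
  ring

/-- The squared `L²`-distance to the normal law is controlled by characteristic functions. -/
theorem ofReal_integral_cdf_sub_sq_le {μ : Measure ℝ} [IsProbabilityMeasure μ]
    (hμ : Integrable (fun x => x) μ) :
    ENNReal.ofReal (∫ x, (cdf μ x - stdNormalCDF x) ^ 2) ≤
      ∫⁻ s, ENNReal.ofReal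
        ((2 * π)⁻¹ * (‖charFun μ s - (exp (-(s ^ 2 / 2)) : ℝ)‖ / |s|) ^ 2) := by
  have hm : Measurable fun x => cdf μ x - stdNormalCDF x :=
    (monotone_cdf _).measurable.sub (monotone_cdf _).measurable
  refine (ofReal_integral_sq_le_lintegral_fourierExp hm (integrable_cdf_sub_stdNormalCDF hμ)
    (abs_cdf_sub_stdNormalCDF_le_one μ) ?_).trans (le_of_eq ?_)
  · have hcount := (monotone_cdf μ).countable_not_continuousAt
    filter_upwards [hcount.ae_notMem volume] with x hx
    simp only [not_not] at hx
    exact hx.sub continuous_stdNormalCDF.continuousAt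
  · refine lintegral_congr_ae ?_
    filter_upwards [(countable_singleton (0 : ℝ)).ae_notMem volume] with s hs
    have := norm_fourierExp_cdf_sub_cdf hμ (integrable_id_gaussianReal 0 1) hs
    rw [charFun_stdNormal] at this
    rw [← this]
    rfl

/-- The Kolmogorov distance to the normal law is controlled by characteristic functions. -/
theorem ofReal_abs_cdf_sub_le {μ : Measure ℝ} [IsProbabilityMeasure μ]
    (hμ : Integrable (fun x => x) μ) {σ : ℝ} (hσ : 0 < σ) (x : ℝ) :
    ENNReal.ofReal |cdf μ x - stdNormalCDF x| ≤
      (∫⁻ s, ENNReal.ofReal (π⁻¹ * exp (-(σ ^ 2 * s ^ 2 / 2)) *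
        (‖charFun μ s - (exp (-(s ^ 2 / 2)) : ℝ)‖ / |s|))) + ENNReal.ofReal (8 * σ) := by
  have hh := integrable_cdf_sub_stdNormalCDF hμ
  set δ := (2 * π)⁻¹ * ∫ s : ℝ, exp (-(σ ^ 2 * s ^ 2 / 2)) *
    ‖fourierExp (fun y => cdf μ y - stdNormalCDF y) s‖ with hδ
  have hv : NNReal.mk (σ ^ 2) (sq_nonneg _) ≠ 0 := by
    rw [ne_eq, ← NNReal.coe_eq_zero]
    exact (pow_pos hσ 2).ne'
  have h1 := abs_sub_le_of_gaussian_smoothing (F := cdf μ) (G := stdNormalCDF) (monotone_cdf _)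
    (monotone_cdf _) (cdf_nonneg _) (cdf_le_one _) (cdf_nonneg _) (cdf_le_one _)
    (fun x y hxy => stdNormalCDF_sub_le hxy) hσ (v := (NNReal.mk (σ ^ 2) (sq_nonneg _))) rfl (δ := δ)
    (fun x => abs_integral_gaussianReal_le hh x hv) x
  have hi := integrable_exp_mul_norm_fourierExp hh (v := σ ^ 2) (pow_pos hσ 2) 1
  simp only [pow_one] at hi
  have h0 : 0 ≤ δ := by positivity
  refine (ENNReal.ofReal_le_ofReal h1).trans ?_
  rw [ENNReal.ofReal_add (by positivity) (by positivity)]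
  gcongr
  have h2 : 2 * δ = ∫ s : ℝ, π⁻¹ * (exp (-(σ ^ 2 * s ^ 2 / 2)) *
    ‖fourierExp (fun y => cdf μ y - stdNormalCDF y) s‖) := by
    rw [integral_const_mul, hδ, ← mul_assoc]
    congr 1
    field_simp
  rw [h2, ofReal_integral_eq_lintegral_ofReal (hi.const_mul _)
    (Filter.Eventually.of_forall fun s => by positivity)]
  refine le_of_eq (lintegral_congr_ae ?_)
  filter_upwards [(countable_singleton (0 : ℝ)).ae_notMem volume] with s hs
  have := norm_fourierExp_cdf_sub_cdf hμ (integrable_id_gaussianReal 0 1) hs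
  rw [charFun_stdNormal] at this
  rw [← this, mul_assoc]
  rfl

/-! ### Polar coordinates for the Gaussian measure -/

theorem lintegral_comp_normalize_mul {n : ℕ} {g : EuclideanSpace ℝ (Fin n) → ENNReal}
    (hg : Measurable g) {k : ℝ → ENNReal} (hk : Measurable k) (hn : 0 < n) :
    ∫⁻ x : EuclideanSpace ℝ (Fin n), g (‖x‖⁻¹ • x) * k ‖x‖ =
      (∫⁻ θ : Metric.sphere (0 : EuclideanSpace ℝ (Fin n)) 1, g θ
        ∂(volume : Measure (EuclideanSpace ℝ (Fin n))).toSphere) *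
      ∫⁻ r : Ioi (0 : ℝ), k r ∂(Measure.volumeIoiPow (n - 1)) := by
  have : Nontrivial (EuclideanSpace ℝ (Fin n)) := by
    have : Nonempty (Fin n) := ⟨⟨0, hn⟩⟩
    infer_instance
  have hmp := (volume : Measure (EuclideanSpace ℝ (Fin n))).measurePreserving_homeomorphUnitSphereProd
  have hG : Measurable fun p : Metric.sphere (0 : EuclideanSpace ℝ (Fin n)) 1 × Ioi (0 : ℝ) =>
      g p.1 * k p.2 :=
    (hg.comp (measurable_subtype_coe.comp measurable_fst)).mul
      (hk.comp (measurable_subtype_coe.comp measurable_snd))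
  have h1 := hmp.lintegral_comp hG
  rw [finrank_euclideanSpace_fin, lintegral_prod_mul (f := fun θ => g (Subtype.val θ))
    (g := fun r => k (Subtype.val r)) (hg.comp measurable_subtype_coe).aemeasurable
    (hk.comp measurable_subtype_coe).aemeasurable] at h1
  rw [← h1]
  simp only [homeomorphUnitSphereProd_apply_fst_coe, homeomorphUnitSphereProd_apply_snd_coe]
  rw [lintegral_subtype_comap (measurableSet_singleton _).compl
    (fun x : EuclideanSpace ℝ (Fin n) => g (‖x‖⁻¹ • x) * k ‖x‖), restrict_compl_singleton]

/-- Direction and length of a Gaussian vector are independent, and the direction is uniform. The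
radial integral is never evaluated: it is eliminated by comparison with g = 1. -/
theorem lintegral_stdGaussMeasure_normalize_mul {n : ℕ} (hn : 0 < n)
    {g : EuclideanSpace ℝ (Fin n) → ENNReal} (hg : Measurable g) {w : ℝ → ENNReal}
    (hw : Measurable w) :
    ∫⁻ x, g (‖x‖⁻¹ • x) * w ‖x‖ ∂(stdGaussMeasure n) =
      (∫⁻ θ, g θ ∂(sphereMeasure n)) * ∫⁻ x, w ‖x‖ ∂(stdGaussMeasure n) := by
  have : Nontrivial (EuclideanSpace ℝ (Fin n)) := by
    have : Nonempty (Fin n) := ⟨⟨0, hn⟩⟩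
    infer_instance
  set ρ : ℝ → ENNReal := fun r => ENNReal.ofReal ((2 * π) ^ (-(n / 2 : ℝ)) * exp (-r ^ 2 / 2))
    with hρ
  have hρm : Measurable ρ := by fun_prop
  have key : ∀ g : EuclideanSpace ℝ (Fin n) → ENNReal, Measurable g →
      ∫⁻ x, g (‖x‖⁻¹ • x) * w ‖x‖ ∂(stdGaussMeasure n) =
      (∫⁻ θ : Metric.sphere (0 : EuclideanSpace ℝ (Fin n)) 1, g θ
        ∂(volume : Measure (EuclideanSpace ℝ (Fin n))).toSphere) *
      ∫⁻ r : Ioi (0 : ℝ), ρ r * w r ∂(Measure.volumeIoiPow (n - 1)) := by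
    intro g hg
    have h0 := lintegral_comp_normalize_mul hg (hρm.mul hw) hn
    simp only [Pi.mul_apply] at h0
    have hm : Measurable fun x : EuclideanSpace ℝ (Fin n) => g (‖x‖⁻¹ • x) * w ‖x‖ :=
      (hg.comp (by fun_prop)).mul (hw.comp measurable_norm)
    rw [← h0, stdGaussMeasure, lintegral_withDensity_eq_lintegral_mul _ (by fun_prop) hm]
    refine lintegral_congr fun x => ?_
    simp only [Pi.mul_apply, hρ]
    ring
  have h1 := key (fun _ => 1) measurable_const
  simp only [one_mul, lintegral_one] at h1
  rw [key g hg, h1, sphereMeasure, lintegral_smul_measure, smul_eq_mul]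
  set T := (volume : Measure (EuclideanSpace ℝ (Fin n))).toSphere univ with hT
  have hT0 : T ≠ 0 := by
    rw [hT, Measure.measure_univ_ne_zero]
    exact Measure.toSphere_ne_zero _
  have hTt : T ≠ ⊤ := measure_ne_top _ _
  set A := ∫⁻ θ : Metric.sphere (0 : EuclideanSpace ℝ (Fin n)) 1, g θ
        ∂(volume : Measure (EuclideanSpace ℝ (Fin n))).toSphere
  set B := ∫⁻ r : Ioi (0 : ℝ), ρ r * w r ∂(Measure.volumeIoiPow (n - 1))
  calc A * B = (T⁻¹ * T) * (A * B) := by rw [ENNReal.inv_mul_cancel hT0 hTt, one_mul]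
    _ = _ := by ring

/-- Chernoff's bound: exp(-|x|²/2) has mean 2^(-n/2) and is at least exp(-n/8) on the set of short
vectors. For n ≥ 2 the quotient is at most exp(-0.4) ≤ 3/4. -/
theorem stdGaussMeasure_real_norm_ge {n : ℕ} (hn : 2 ≤ n) :
    1 / 4 ≤ (stdGaussMeasure n).real {x | √n / 2 ≤ ‖x‖} := by
  have hmeas : MeasurableSet {x : EuclideanSpace ℝ (Fin n) | √n / 2 ≤ ‖x‖} :=
    measurableSet_le measurable_const measurable_norm
  have hn0 : (2 : ℝ) ≤ n := by exact_mod_cast hn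
  have hint : Integrable (fun x : EuclideanSpace ℝ (Fin n) => exp (-(‖x‖ ^ 2 / 2)))
      (stdGaussMeasure n) :=
    integrable_of_continuous_of_norm_le_one (by fun_prop) fun x => by
      rw [norm_of_nonneg (exp_pos _).le, exp_le_one_iff]
      have := sq_nonneg ‖x‖
      linarith
  have h1 : ∫ x : EuclideanSpace ℝ (Fin n), exp (-(‖x‖ ^ 2 / 2)) ∂(stdGaussMeasure n) =
      2 ^ (-(n / 2 : ℝ)) := by
    have := integral_cexp_inner_mul_exp_stdGaussMeasure (0 : EuclideanSpace ℝ (Fin n)) zero_le_one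
    simp only [inner_zero_left, Complex.ofReal_zero, zero_mul, Complex.exp_zero, one_mul,
      integral_complex_ofReal, Complex.ofReal_inj] at this
    rw [this]
    norm_num
  have h2 := mul_meas_ge_le_integral_of_nonneg
    (Filter.Eventually.of_forall fun x => (exp_pos _).le) hint (exp (-(n / 8 : ℝ)))
  rw [h1] at h2
  have h3 : {x : EuclideanSpace ℝ (Fin n) | √n / 2 ≤ ‖x‖}ᶜ ⊆
      {x | exp (-(n / 8 : ℝ)) ≤ exp (-(‖x‖ ^ 2 / 2))} := by
    intro x hx
    have hx' : ‖x‖ < √n / 2 := not_le.1 hx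
    have h4 : ‖x‖ ^ 2 ≤ (√n / 2) ^ 2 := by gcongr
    rw [div_pow, sq_sqrt (by positivity)] at h4
    refine exp_le_exp.2 ?_
    linarith
  have h4 : (stdGaussMeasure n).real {x | √n / 2 ≤ ‖x‖}ᶜ ≤ 3 / 4 := by
    refine (measureReal_mono h3).trans ?_
    have h5 : exp (-(n / 8 : ℝ)) * (3 / 4) ≥ 2 ^ (-(n / 2 : ℝ)) := by
      have h6 : exp (-(4 / 10 : ℝ)) ≤ 3 / 4 := by
        rw [exp_neg, inv_le_comm₀ (exp_pos _) (by norm_num)]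
        have := add_one_le_exp (4 / 10 : ℝ)
        linarith
      have h7 : (2 : ℝ) ^ (-(n / 2 : ℝ)) ≤ exp (-(n / 8 : ℝ)) * exp (-(4 / 10 : ℝ)) := by
        rw [rpow_def_of_pos (by norm_num), ← exp_add]
        refine exp_le_exp.2 ?_
        have := log_two_gt_d9
        nlinarith
      exact h7.trans (by gcongr)
    have := h2.trans h5
    exact le_of_mul_le_mul_left this (exp_pos _)
  have h5 := probReal_compl_eq_one_sub (μ := stdGaussMeasure n) hmeas
  linarith

/-- Averages over the sphere are bounded by Gaussian averages over vectors of typical length. -/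
theorem lintegral_sphereMeasure_le {n : ℕ} (hn : 2 ≤ n)
    {g : EuclideanSpace ℝ (Fin n) → ENNReal} (hg : Measurable g) :
    ∫⁻ θ, g θ ∂(sphereMeasure n) ≤
      4 * ∫⁻ x in {x | √n / 2 ≤ ‖x‖}, g (‖x‖⁻¹ • x) ∂(stdGaussMeasure n) := by
  have hmeas : MeasurableSet {x : EuclideanSpace ℝ (Fin n) | √n / 2 ≤ ‖x‖} :=
    measurableSet_le measurable_const measurable_norm
  have hw : Measurable ((Ici (√n / 2)).indicator (1 : ℝ → ENNReal)) :=
    measurable_one.indicator measurableSet_Ici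
  have h1 := lintegral_stdGaussMeasure_normalize_mul (by omega) hg hw
  have h2 : ∀ x : EuclideanSpace ℝ (Fin n), (Ici (√n / 2)).indicator (1 : ℝ → ENNReal) ‖x‖ =
      {x : EuclideanSpace ℝ (Fin n) | √n / 2 ≤ ‖x‖}.indicator 1 x := fun x => rfl
  have h3 : ∀ x : EuclideanSpace ℝ (Fin n),
      g (‖x‖⁻¹ • x) * (Ici (√n / 2)).indicator (1 : ℝ → ENNReal) ‖x‖ =
      {x : EuclideanSpace ℝ (Fin n) | √n / 2 ≤ ‖x‖}.indicator (fun x => g (‖x‖⁻¹ • x)) x := by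
    intro x
    rw [h2]
    by_cases h : x ∈ {x : EuclideanSpace ℝ (Fin n) | √n / 2 ≤ ‖x‖} <;> simp [h]
  simp_rw [h3, h2] at h1
  rw [lintegral_indicator hmeas, lintegral_indicator_one hmeas] at h1
  rw [h1]
  have h4 : 1 ≤ 4 * stdGaussMeasure n {x | √n / 2 ≤ ‖x‖} := by
    have h5 := stdGaussMeasure_real_norm_ge hn
    have h6 : ENNReal.ofReal (1 / 4) ≤ stdGaussMeasure n {x | √n / 2 ≤ ‖x‖} := by
      rw [← ofReal_measureReal]
      exact ENNReal.ofReal_le_ofReal h5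
    calc (1 : ENNReal) = 4 * ENNReal.ofReal (1 / 4) := by
          rw [← ENNReal.ofReal_ofNat 4, ← ENNReal.ofReal_mul (by norm_num)]; norm_num
      _ ≤ _ := by gcongr
  calc ∫⁻ θ, g θ ∂(sphereMeasure n) = (∫⁻ θ, g θ ∂(sphereMeasure n)) * 1 := by rw [mul_one]
    _ ≤ (∫⁻ θ, g θ ∂(sphereMeasure n)) * (4 * stdGaussMeasure n {x | √n / 2 ≤ ‖x‖}) := by gcongr
    _ = _ := by ring

/-! ### Distances of one-dimensional projections to the normal law -/

/-- The law of the projection of `Q` in the direction `v`. -/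
noncomputable def projLaw {n : ℕ} (Q : Measure (EuclideanSpace ℝ (Fin n)))
    (v : EuclideanSpace ℝ (Fin n)) : Measure ℝ :=
  Q.map fun y => inner ℝ y v

instance isProbabilityMeasure_projLaw {n : ℕ} (Q : Measure (EuclideanSpace ℝ (Fin n)))
    [IsProbabilityMeasure Q] (v : EuclideanSpace ℝ (Fin n)) :
    IsProbabilityMeasure (projLaw Q v) :=
  Measure.isProbabilityMeasure_map (by fun_prop)

theorem charFun_projLaw {n : ℕ} (Q : Measure (EuclideanSpace ℝ (Fin n)))
    (v : EuclideanSpace ℝ (Fin n)) (s : ℝ) : charFun (projLaw Q v) s = charFun Q (s • v) := by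
  rw [charFun_apply_real, projLaw, integral_map (by fun_prop) (by fun_prop), charFun_apply]
  simp only [inner_smul_right]
  push_cast
  rfl

theorem integrable_id_projLaw {n : ℕ} {Q : Measure (EuclideanSpace ℝ (Fin n))}
    [IsProbabilityMeasure Q] {R : ℝ} (hR : ∀ᵐ y ∂Q, ‖y‖ ≤ R) (v : EuclideanSpace ℝ (Fin n)) :
    Integrable (fun x => x) (projLaw Q v) := by
  rw [projLaw, integrable_map_measure (by fun_prop) (by fun_prop)]
  refine Integrable.of_bound (by fun_prop) (R * ‖v‖) ?_
  filter_upwards [hR] with y hy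
  exact (norm_inner_le_norm y v).trans (by gcongr)

/-- The difference between the characteristic functions of `Q` and of the standard normal law. -/
noncomputable def charDiff {n : ℕ} (Q : Measure (EuclideanSpace ℝ (Fin n)))
    (v : EuclideanSpace ℝ (Fin n)) : ℝ :=
  ‖charFun Q v - (exp (-(‖v‖ ^ 2 / 2)) : ℝ)‖

theorem charDiff_nonneg {n : ℕ} (Q : Measure (EuclideanSpace ℝ (Fin n)))
    (v : EuclideanSpace ℝ (Fin n)) : 0 ≤ charDiff Q v := norm_nonneg _

theorem continuous_charDiff {n : ℕ} (Q : Measure (EuclideanSpace ℝ (Fin n)))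
    [IsProbabilityMeasure Q] : Continuous (charDiff Q) := by
  unfold charDiff
  have : Continuous (charFun Q) := by fun_prop
  fun_prop

theorem norm_charFun_projLaw_sub {n : ℕ} (Q : Measure (EuclideanSpace ℝ (Fin n)))
    {v : EuclideanSpace ℝ (Fin n)} (hv : ‖v‖ = 1) (s : ℝ) :
    ‖charFun (projLaw Q v) s - (exp (-(s ^ 2 / 2)) : ℝ)‖ = charDiff Q (s • v) := by
  rw [charFun_projLaw, charDiff, norm_smul, hv, mul_one, norm_eq_abs, sq_abs]

theorem lintegral_eq_mul_lintegral_comp_mul {r : ℝ} (hr : 0 < r) {f : ℝ → ENNReal}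
    (hf : Measurable f) : ∫⁻ s, f s = ENNReal.ofReal r * ∫⁻ s, f (r * s) := by
  conv_lhs => rw [← Real.smul_map_volume_mul_left hr.ne']
  rw [lintegral_smul_measure, lintegral_map hf (by fun_prop), abs_of_pos hr, smul_eq_mul]

theorem smul_normalize_eq {n : ℕ} (x : EuclideanSpace ℝ (Fin n)) (hx : ‖x‖ ≠ 0) (s : ℝ) :
    ((‖x‖ / √n) * s) • (‖x‖⁻¹ • x) = (s / √n) • x := by
  rw [smul_smul]
  congr 1
  field_simp

section Projection

variable {n : ℕ} {Q : Measure (EuclideanSpace ℝ (Fin n))} [IsProbabilityMeasure Q]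

/-- Rescaling s by ‖x‖/√n exchanges the unit direction for x itself, whose mean can be computed.
Since ds/s² is not scale invariant, a factor √n/‖x‖ ≤ 2 remains. -/
theorem ofReal_integral_cdf_projLaw_sub_sq_le {R : ℝ} (hR : ∀ᵐ y ∂Q, ‖y‖ ≤ R) (hn : 0 < n)
    {x : EuclideanSpace ℝ (Fin n)} (hx : √n / 2 ≤ ‖x‖) :
    ENNReal.ofReal (∫ y, (cdf (projLaw Q (‖x‖⁻¹ • x)) y - stdNormalCDF y) ^ 2) ≤
      2 * ∫⁻ s, ENNReal.ofReal ((2 * π)⁻¹ * (charDiff Q ((s / √n) • x) / |s|) ^ 2) := by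
  have hn0 : 0 < √(n : ℝ) := sqrt_pos.2 (by exact_mod_cast hn)
  have hx0 : 0 < ‖x‖ := by linarith
  have hnorm : ‖‖x‖⁻¹ • x‖ = 1 := by
    rw [norm_smul, norm_inv, norm_norm, inv_mul_cancel₀ hx0.ne']
  have hr : 0 < ‖x‖ / √n := by positivity
  refine (ofReal_integral_cdf_sub_sq_le (integrable_id_projLaw hR _)).trans ?_
  simp only [norm_charFun_projLaw_sub Q hnorm]
  have hcont := continuous_charDiff Q
  rw [lintegral_eq_mul_lintegral_comp_mul hr]
  · have h1 : ∀ s : ℝ, ENNReal.ofReal ((2 * π)⁻¹ *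
        (charDiff Q (((‖x‖ / √n) * s) • (‖x‖⁻¹ • x)) / |‖x‖ / √n * s|) ^ 2) =
        ENNReal.ofReal (((‖x‖ / √n) ^ 2)⁻¹) *
          ENNReal.ofReal ((2 * π)⁻¹ * (charDiff Q ((s / √n) • x) / |s|) ^ 2) := by
      intro s
      rw [smul_normalize_eq x hx0.ne', ← ENNReal.ofReal_mul (by positivity), abs_mul,
        abs_of_pos hr]
      congr 1
      field_simp
    simp_rw [h1]
    rw [lintegral_const_mul _ (by fun_prop), ← mul_assoc, ← ENNReal.ofReal_mul hr.le]
    gcongr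
    refine ENNReal.ofReal_le_of_le_toReal ?_
    rw [ENNReal.toReal_ofNat]
    have h2 : ‖x‖ / √n * ((‖x‖ / √n) ^ 2)⁻¹ = √n / ‖x‖ := by field_simp
    rw [h2, div_le_iff₀ hx0]
    linarith
  · fun_prop

theorem ofReal_kolmogorovDist_le {F G : ℝ → ℝ} {a : ENNReal}
    (h : ∀ x, ENNReal.ofReal |F x - G x| ≤ a) : ENNReal.ofReal (kolmogorovDist F G) ≤ a := by
  by_cases ha : a = ⊤
  · simp [ha]
  rw [ENNReal.ofReal_le_iff_le_toReal ha]
  exact ciSup_le fun x => (ENNReal.ofReal_le_iff_le_toReal ha).1 (h x)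

/-- The smoothing width is taken as 1/(nr) with r = ‖x‖/√n, so that after rescaling s by r the
cut-off no longer depends on x. Here ds/|s| is scale invariant, and r ≥ 1/2 bounds the smoothing
error by 16/n. -/
theorem ofReal_kolmogorovDist_projLaw_le {R : ℝ} (hR : ∀ᵐ y ∂Q, ‖y‖ ≤ R) (hn : 0 < n)
    {x : EuclideanSpace ℝ (Fin n)} (hx : √n / 2 ≤ ‖x‖) :
    ENNReal.ofReal (kolmogorovDist (cdf (projLaw Q (‖x‖⁻¹ • x))) stdNormalCDF) ≤
      (∫⁻ s, ENNReal.ofReal (π⁻¹ * exp (-(s ^ 2 / (2 * n ^ 2))) *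
        (charDiff Q ((s / √n) • x) / |s|))) + ENNReal.ofReal (16 / n) := by
  have hn1 : 0 < (n : ℝ) := by exact_mod_cast hn
  have hn0 : 0 < √(n : ℝ) := sqrt_pos.2 hn1
  have hx0 : 0 < ‖x‖ := by linarith
  have hnorm : ‖‖x‖⁻¹ • x‖ = 1 := by
    rw [norm_smul, norm_inv, norm_norm, inv_mul_cancel₀ hx0.ne']
  set r := ‖x‖ / √n with hrdef
  have hr : 0 < r := by positivity
  have hr2 : 1 / 2 ≤ r := by rw [hrdef, le_div_iff₀ hn0]; linarith
  have hσ : 0 < 1 / (n * r) := by positivity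
  have hcont := continuous_charDiff Q
  refine ofReal_kolmogorovDist_le fun y => ?_
  refine (ofReal_abs_cdf_sub_le (integrable_id_projLaw hR _) hσ y).trans ?_
  simp only [norm_charFun_projLaw_sub Q hnorm]
  refine add_le_add (le_of_eq ?_) (ENNReal.ofReal_le_ofReal ?_)
  · rw [lintegral_eq_mul_lintegral_comp_mul hr]
    · rw [← lintegral_const_mul _ (by fun_prop)]
      refine lintegral_congr fun s => ?_
      rw [smul_normalize_eq x hx0.ne', ← ENNReal.ofReal_mul hr.le, abs_mul, abs_of_pos hr]
      congr 1
      have h1 : (1 / (n * r)) ^ 2 * (r * s) ^ 2 / 2 = s ^ 2 / (2 * n ^ 2) := by field_simp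
      rw [h1]
      field_simp
    · fun_prop
  · rw [mul_one_div, div_le_div_iff₀ (by positivity) (by positivity)]
    nlinarith

theorem measurable_cdf_projLaw : Measurable fun p : EuclideanSpace ℝ (Fin n) × ℝ =>
    cdf (projLaw Q p.1) p.2 := by
  have h1 : ∀ p : EuclideanSpace ℝ (Fin n) × ℝ, cdf (projLaw Q p.1) p.2 =
      (Q (Prod.mk p ⁻¹' {z : (EuclideanSpace ℝ (Fin n) × ℝ) × EuclideanSpace ℝ (Fin n) |
        inner ℝ z.2 z.1.1 ≤ z.1.2})).toReal := by
    intro p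
    rw [cdf_eq_real, projLaw, map_measureReal_apply (by fun_prop) measurableSet_Iic]
    rfl
  simp_rw [h1]
  refine (measurable_measure_prodMk_left ?_).ennreal_toReal
  exact measurableSet_le (by fun_prop) (by fun_prop)

theorem measurable_integral_cdf_projLaw_sub_sq : Measurable fun v : EuclideanSpace ℝ (Fin n) =>
    ∫ y, (cdf (projLaw Q v) y - stdNormalCDF y) ^ 2 := by
  refine StronglyMeasurable.measurable (StronglyMeasurable.integral_prod_right ?_)
  refine Measurable.stronglyMeasurable ?_
  exact (measurable_cdf_projLaw.sub
    (continuous_stdNormalCDF.measurable.comp measurable_snd)).pow_const 2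

open Filter Topology in
-- Right continuity lets a countable supremum suffice, which is what makes the Kolmogorov distance
-- measurable in the direction.
theorem kolmogorovDist_cdf_eq_iSup_rat (μ : Measure ℝ) :
    kolmogorovDist (cdf μ) stdNormalCDF = ⨆ q : ℚ, |cdf μ q - stdNormalCDF q| := by
  have hb : BddAbove (range fun x : ℝ => |cdf μ x - stdNormalCDF x|) :=
    ⟨1, by rintro _ ⟨x, rfl⟩; exact abs_cdf_sub_stdNormalCDF_le_one μ x⟩
  have hbq : BddAbove (range fun q : ℚ => |cdf μ q - stdNormalCDF q|) :=
    ⟨1, by rintro _ ⟨x, rfl⟩; exact abs_cdf_sub_stdNormalCDF_le_one μ x⟩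
  refine le_antisymm (ciSup_le fun x => ?_) (ciSup_le fun q => le_ciSup hb (q : ℝ))
  by_contra! hlt
  have hc : ContinuousWithinAt (fun x => |cdf μ x - stdNormalCDF x|) (Ici x) x :=
    (((cdf μ).right_continuous x).sub continuous_stdNormalCDF.continuousWithinAt).abs
  have hev := (hc.tendsto.eventually_const_lt hlt)
  have hev' := hev.filter_mono (nhdsWithin_mono x Ioi_subset_Ici_self)
  obtain ⟨b, hxb, hb'⟩ := mem_nhdsGT_iff_exists_Ioo_subset.1 hev'
  obtain ⟨q, hq1, hq2⟩ := exists_rat_btwn (show x < b from hxb)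
  exact absurd (le_ciSup hbq q) (not_le.2 (hb' ⟨hq1, hq2⟩))

theorem measurable_kolmogorovDist_projLaw : Measurable fun v : EuclideanSpace ℝ (Fin n) =>
    kolmogorovDist (cdf (projLaw Q v)) stdNormalCDF := by
  simp_rw [kolmogorovDist_cdf_eq_iSup_rat]
  refine Measurable.iSup fun q => ?_
  exact ((measurable_cdf_projLaw.comp measurable_prodMk_right).sub_const _).abs

end Projection

theorem kolmogorovDist_cdf_nonneg (μ : Measure ℝ) : 0 ≤ kolmogorovDist (cdf μ) stdNormalCDF :=
  Real.iSup_nonneg fun _ => abs_nonneg _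

/-- Cauchy–Schwarz between f and the constant 1 under the measure with density w. -/
theorem lintegral_mul_sq_le {α : Type*} [MeasurableSpace α] {μ : Measure α} {w f : α → ENNReal}
    (hw : Measurable w) (hf : Measurable f) :
    (∫⁻ a, w a * f a ∂μ) ^ 2 ≤ (∫⁻ a, w a ∂μ) * ∫⁻ a, w a * f a ^ 2 ∂μ := by
  have h := ENNReal.lintegral_mul_le_Lp_mul_Lq (μ.withDensity w) Real.HolderConjugate.two_two
    (f := fun _ => 1) (g := f) aemeasurable_const hf.aemeasurable
  simp only [Pi.mul_apply, one_mul, ENNReal.one_rpow] at h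
  have e0 : ∀ g : α → ENNReal, Measurable g →
      ∫⁻ a, g a ∂(μ.withDensity w) = ∫⁻ a, w a * g a ∂μ := fun g hg => by
    rw [lintegral_withDensity_eq_lintegral_mul _ hw hg]; rfl
  have e1 := e0 f hf
  have e2 := e0 (fun _ => 1) measurable_const
  have e3 := e0 (fun a => f a ^ (2 : ℝ)) (hf.pow_const _)
  simp only [mul_one] at e2
  rw [e1, e2, e3] at h
  calc (∫⁻ a, w a * f a ∂μ) ^ 2 ≤ ((∫⁻ a, w a ∂μ) ^ (1 / 2 : ℝ) *
        (∫⁻ a, w a * f a ^ (2 : ℝ) ∂μ) ^ (1 / 2 : ℝ)) ^ 2 := by gcongr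
    _ = _ := by
      rw [mul_pow, ← ENNReal.rpow_natCast, ← ENNReal.rpow_natCast, ← ENNReal.rpow_mul,
        ← ENNReal.rpow_mul]
      norm_num

/-! ### Averages over the sphere -/

theorem min_one_sq_div_sq_le (s : ℝ) : min 1 (s ^ 2) / |s| ^ 2 ≤ 2 * (1 + s ^ 2)⁻¹ := by
  rw [sq_abs]
  rcases eq_or_ne s 0 with rfl | hs
  · norm_num
  have hs2 : 0 < s ^ 2 := by positivity
  rw [← div_eq_mul_inv, div_le_div_iff₀ hs2 (by positivity)]
  rcases le_total 1 (s ^ 2) with h | h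
  · rw [min_eq_left h]; linarith
  · rw [min_eq_right h]; nlinarith

theorem min_one_abs_sq (s : ℝ) : min 1 |s| ^ 2 = min 1 (s ^ 2) := by
  rcases le_total 1 |s| with h | h
  · rw [min_eq_left h, min_eq_left, one_pow]
    rw [← sq_abs]; nlinarith
  · rw [min_eq_right h, min_eq_right, sq_abs]
    rw [← sq_abs]; nlinarith [abs_nonneg s]

/-- The weight used to estimate the smoothed distance of distribution functions. -/
noncomputable def logWeight (n : ℕ) (s : ℝ) : ℝ :=
  exp (-(s ^ 2 / (2 * n ^ 2))) * (min 1 |s| / |s|)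

theorem logWeight_nonneg (n : ℕ) (s : ℝ) : 0 ≤ logWeight n s := by
  unfold logWeight
  have : 0 ≤ min 1 |s| := le_min zero_le_one (abs_nonneg s)
  positivity

theorem measurable_logWeight (n : ℕ) : Measurable (logWeight n) := by
  unfold logWeight
  fun_prop

theorem logWeight_neg (n : ℕ) (s : ℝ) : logWeight n (-s) = logWeight n s := by
  simp [logWeight]

theorem lintegral_Ioi_ofReal_le {f : ℝ → ℝ} {a I : ℝ} (hf : IntegrableOn f (Ioi a))
    (hI : ∫ s in Ioi a, f s ≤ I) (h0 : ∀ s ∈ Ioi a, 0 ≤ f s) :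
    ∫⁻ s in Ioi a, ENNReal.ofReal (f s) ≤ ENNReal.ofReal I := by
  rw [← ofReal_integral_eq_lintegral_ofReal hf
    ((ae_restrict_mem measurableSet_Ioi).mono h0)]
  exact ENNReal.ofReal_le_ofReal hI

theorem lintegral_Ioc_inv {n : ℕ} (hn : 1 ≤ n) :
    ∫⁻ s in Ioc (1 : ℝ) n, ENNReal.ofReal s⁻¹ = ENNReal.ofReal (log n) := by
  have h1 : (1 : ℝ) ≤ n := by exact_mod_cast hn
  have hint : IntervalIntegrable (fun s : ℝ => s⁻¹) volume 1 n :=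
    intervalIntegral.intervalIntegrable_inv
      (fun s hs => by rw [uIcc_of_le h1] at hs; linarith [hs.1])
      (by fun_prop)
  rw [← ofReal_integral_eq_lintegral_ofReal, ← intervalIntegral.integral_of_le h1,
    integral_inv_of_pos zero_lt_one (by linarith), div_one]
  · exact (intervalIntegrable_iff_integrableOn_Ioc_of_le h1).1 hint
  · refine (ae_restrict_mem measurableSet_Ioc).mono fun s hs => ?_
    exact inv_nonneg.2 (by linarith [hs.1])

/-- The weight is at most 1 on (0, 1] and at most 1/s on (1, n]. Beyond n the bound exp(-z) ≤ 1/z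
gives 2n²/s³, whose integral is 1. -/
theorem lintegral_Ioi_logWeight_le {n : ℕ} (hn : 1 ≤ n) :
    ∫⁻ s in Ioi (0 : ℝ), ENNReal.ofReal (logWeight n s) ≤ ENNReal.ofReal (2 + log n) := by
  have h1 : (1 : ℝ) ≤ n := by exact_mod_cast hn
  have hsplit : Ioi (0 : ℝ) = Ioc 0 1 ∪ (Ioc 1 (n : ℝ) ∪ Ioi (n : ℝ)) := by
    rw [Ioc_union_Ioi_eq_Ioi h1, Ioc_union_Ioi_eq_Ioi zero_le_one]
  have hexp : ∀ s : ℝ, exp (-(s ^ 2 / (2 * n ^ 2))) ≤ 1 := fun s => by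
    rw [exp_le_one_iff, neg_nonpos]; positivity
  have b1 : ∫⁻ s in Ioc (0 : ℝ) 1, ENNReal.ofReal (logWeight n s) ≤ ENNReal.ofReal 1 := by
    calc _ ≤ ∫⁻ s in Ioc (0 : ℝ) 1, 1 := by
          refine setLIntegral_mono measurable_const fun s hs => ?_
          rw [← ENNReal.ofReal_one]
          refine ENNReal.ofReal_le_ofReal (mul_le_one₀ (hexp s) ?_ ?_)
          · have : 0 ≤ min 1 |s| := le_min zero_le_one (abs_nonneg s)
            positivity
          · exact div_le_one_of_le₀ (min_le_right _ _) (abs_nonneg _)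
      _ = _ := by simp
  have b2 : ∫⁻ s in Ioc (1 : ℝ) n, ENNReal.ofReal (logWeight n s) ≤ ENNReal.ofReal (log n) := by
    rw [← lintegral_Ioc_inv hn]
    refine setLIntegral_mono (by fun_prop) fun s hs => ENNReal.ofReal_le_ofReal ?_
    have hs0 : 0 < s := by linarith [hs.1]
    rw [logWeight, abs_of_pos hs0, min_eq_left hs.1.le, one_div]
    exact mul_le_of_le_one_left (by positivity) (hexp s)
  have b3 : ∫⁻ s in Ioi (n : ℝ), ENNReal.ofReal (logWeight n s) ≤ ENNReal.ofReal 1 := by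
    calc _ ≤ ∫⁻ s in Ioi (n : ℝ), ENNReal.ofReal (2 * n ^ 2 * s ^ (-3 : ℝ)) := by
          refine setLIntegral_mono (by fun_prop) fun s hs => ENNReal.ofReal_le_ofReal ?_
          have hs0 : 0 < s := by linarith [show (n : ℝ) < s from hs]
          have hs1 : 1 ≤ s := by linarith [show (n : ℝ) < s from hs]
          rw [logWeight, abs_of_pos hs0, min_eq_left hs1]
          have h2 : exp (-(s ^ 2 / (2 * n ^ 2))) ≤ 2 * n ^ 2 / s ^ 2 := by
            rw [exp_neg, inv_le_comm₀ (exp_pos _) (by positivity), inv_div]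
            linarith [add_one_le_exp (s ^ 2 / (2 * n ^ 2))]
          have h3 : s ^ (-3 : ℝ) = 1 / s ^ 3 := by
            rw [rpow_neg hs0.le, one_div]; norm_cast
          rw [h3]
          calc _ ≤ 2 * n ^ 2 / s ^ 2 * (1 / s) := by gcongr
            _ = _ := by field_simp
      _ ≤ _ := by
          have hn0 : (0 : ℝ) < n := by linarith
          refine lintegral_Ioi_ofReal_le
            ((integrableOn_Ioi_rpow_of_lt (by norm_num) hn0).const_mul _) ?_ ?_
          · rw [integral_const_mul, integral_Ioi_rpow_of_lt (by norm_num) hn0]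
            norm_num
            field_simp
            norm_num
          · intro s hs
            have hs0 : 0 < s := by linarith [show (n : ℝ) < s from hs]
            positivity
  rw [hsplit]
  refine (lintegral_union_le _ _ _).trans ?_
  refine (add_le_add b1 ((lintegral_union_le _ _ _).trans (add_le_add b2 b3))).trans ?_
  rw [← ENNReal.ofReal_add (log_nonneg h1) zero_le_one,
    ← ENNReal.ofReal_add zero_le_one (by linarith [log_nonneg h1])]
  refine ENNReal.ofReal_le_ofReal ?_
  linarith

theorem lintegral_logWeight_le {n : ℕ} (hn : 2 ≤ n) :
    ∫⁻ s, ENNReal.ofReal (logWeight n s) ≤ ENNReal.ofReal (8 * log n) := by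
  have hpos := lintegral_Ioi_logWeight_le (n := n) (by omega)
  have hneg : ∫⁻ s in Iic (0 : ℝ), ENNReal.ofReal (logWeight n s) =
      ∫⁻ s in Ioi (0 : ℝ), ENNReal.ofReal (logWeight n s) := by
    have h := (Measure.measurePreserving_neg (volume : Measure ℝ)).setLIntegral_comp_preimage
      (s := Ici 0) (f := fun s => ENNReal.ofReal (logWeight n s)) measurableSet_Ici
      (measurable_logWeight n).ennreal_ofReal
    simp only [logWeight_neg] at h
    rw [setLIntegral_congr (Ioi_ae_eq_Ici (a := (0 : ℝ))), ← h]
    simp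
  rw [← lintegral_add_compl _ (measurableSet_Ioi (a := (0 : ℝ))), compl_Ioi, hneg]
  refine (add_le_add hpos hpos).trans ?_
  -- The claim 4 + 2 log n ≤ 8 log n requires log n ≥ 2/3, and log 2 lies just above that.
  have h2 : log 2 ≤ log n := log_le_log (by norm_num) (by exact_mod_cast hn)
  have h3 := log_two_gt_d9
  rw [← ENNReal.ofReal_add (by linarith) (by linarith)]
  exact ENNReal.ofReal_le_ofReal (by linarith)

section Average

variable {n : ℕ} {Q : Measure (EuclideanSpace ℝ (Fin n))} [IsProbabilityMeasure Q]

theorem lintegral_charDiff_sq_le {C : ℝ}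
    (hM : ∀ s : ℝ, ∫ x, charDiff Q ((s / √n) • x) ^ 2 ∂(stdGaussMeasure n) ≤
      C * min 1 (s ^ 2) / n ^ 2) (s : ℝ) :
    ∫⁻ x, ENNReal.ofReal (charDiff Q ((s / √n) • x) ^ 2) ∂(stdGaussMeasure n) ≤
      ENNReal.ofReal (C * min 1 (s ^ 2) / n ^ 2) := by
  have hcont := continuous_charDiff Q
  have hint : Integrable (fun x => charDiff Q ((s / √n) • x) ^ 2) (stdGaussMeasure n) := by
    refine Integrable.of_bound (by fun_prop) ((1 + 1) ^ 2) (Filter.Eventually.of_forall fun x => ?_)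
    rw [norm_pow, norm_of_nonneg (charDiff_nonneg _ _)]
    gcongr
    · exact charDiff_nonneg _ _
    refine (norm_sub_le _ _).trans (add_le_add (norm_charFun_le_one _) ?_)
    rw [Complex.norm_real, norm_of_nonneg (exp_pos _).le, exp_le_one_iff, neg_nonpos]
    positivity
  rw [← ofReal_integral_eq_lintegral_ofReal hint
    (Filter.Eventually.of_forall fun x => sq_nonneg _)]
  exact ENNReal.ofReal_le_ofReal (hM s)

/-- After exchanging the integrals, each frequency contributes at most a multiple of C min(1,
s²)/(n² s²), which is integrable. In the constant 8, a factor 4 comes from passing to Gaussian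
vectors and 2 from rescaling; the π from integrating 1/(1 + s²) cancels. -/
theorem lintegral_sphere_l2_le {R C : ℝ} (hR : ∀ᵐ y ∂Q, ‖y‖ ≤ R) (hn : 2 ≤ n) (hC : 0 ≤ C)
    (hM : ∀ s : ℝ, ∫ x, charDiff Q ((s / √n) • x) ^ 2 ∂(stdGaussMeasure n) ≤
      C * min 1 (s ^ 2) / n ^ 2) :
    ∫⁻ θ : Metric.sphere (0 : EuclideanSpace ℝ (Fin n)) 1,
      ENNReal.ofReal (∫ y, (cdf (projLaw Q θ) y - stdNormalCDF y) ^ 2) ∂(sphereMeasure n) ≤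
      ENNReal.ofReal (8 * C / n ^ 2) := by
  have hn0 : (0 : ℝ) < n := by exact_mod_cast (by omega : 0 < n)
  have hcont := continuous_charDiff Q
  have hmeas : MeasurableSet {x : EuclideanSpace ℝ (Fin n) | √n / 2 ≤ ‖x‖} :=
    measurableSet_le measurable_const measurable_norm
  refine (lintegral_sphereMeasure_le hn
    (measurable_integral_cdf_projLaw_sub_sq (Q := Q)).ennreal_ofReal).trans ?_
  have h1 : ∫⁻ x in {x | √n / 2 ≤ ‖x‖}, ENNReal.ofReal
      (∫ y, (cdf (projLaw Q (‖x‖⁻¹ • x)) y - stdNormalCDF y) ^ 2) ∂(stdGaussMeasure n) ≤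
      ∫⁻ x, 2 * (∫⁻ s : ℝ, ENNReal.ofReal ((2 * π)⁻¹ * (charDiff Q ((s / √n) • x) / |s|) ^ 2))
        ∂(stdGaussMeasure n) := by
    refine (setLIntegral_mono' hmeas fun x hx => ?_).trans (setLIntegral_le_lintegral _ _)
    exact ofReal_integral_cdf_projLaw_sub_sq_le hR (by omega) hx
  refine (mul_le_mul_right h1 4).trans ?_
  have hjm : Measurable (Function.uncurry fun (x : EuclideanSpace ℝ (Fin n)) (s : ℝ) =>
      ENNReal.ofReal ((2 * π)⁻¹ * (charDiff Q ((s / √n) • x) / |s|) ^ 2)) := by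
    simp only [Function.uncurry_def]
    have : Measurable fun p : EuclideanSpace ℝ (Fin n) × ℝ => charDiff Q ((p.2 / √n) • p.1) :=
      (by fun_prop : Continuous fun p : EuclideanSpace ℝ (Fin n) × ℝ =>
        charDiff Q ((p.2 / √n) • p.1)).measurable
    fun_prop
  have hm2 : Measurable fun x : EuclideanSpace ℝ (Fin n) =>
      ∫⁻ s : ℝ, ENNReal.ofReal ((2 * π)⁻¹ * (charDiff Q ((s / √n) • x) / |s|) ^ 2) :=
    hjm.lintegral_prod_right'
  rw [lintegral_const_mul _ hm2, lintegral_lintegral_swap hjm.aemeasurable]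
  have h2 : ∀ s : ℝ, ∫⁻ x, ENNReal.ofReal ((2 * π)⁻¹ * (charDiff Q ((s / √n) • x) / |s|) ^ 2)
      ∂(stdGaussMeasure n) ≤ ENNReal.ofReal (C / (π * n ^ 2) * (1 + s ^ 2)⁻¹) := by
    intro s
    have h3 : ∀ x, ENNReal.ofReal ((2 * π)⁻¹ * (charDiff Q ((s / √n) • x) / |s|) ^ 2) =
        ENNReal.ofReal ((2 * π)⁻¹ / |s| ^ 2) * ENNReal.ofReal (charDiff Q ((s / √n) • x) ^ 2) := by
      intro x
      rw [← ENNReal.ofReal_mul (by positivity)]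
      congr 1
      ring
    simp_rw [h3]
    rw [lintegral_const_mul _ (by fun_prop)]
    refine (mul_le_mul_right (lintegral_charDiff_sq_le hM s) _).trans ?_
    rw [← ENNReal.ofReal_mul (by positivity)]
    refine ENNReal.ofReal_le_ofReal ?_
    calc (2 * π)⁻¹ / |s| ^ 2 * (C * min 1 (s ^ 2) / n ^ 2) =
          (2 * π)⁻¹ * C / n ^ 2 * (min 1 (s ^ 2) / |s| ^ 2) := by ring
      _ ≤ (2 * π)⁻¹ * C / n ^ 2 * (2 * (1 + s ^ 2)⁻¹) := by
          gcongr
          exact min_one_sq_div_sq_le s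
      _ = _ := by field_simp
  have h4 : ∫⁻ s : ℝ, ENNReal.ofReal (C / (π * n ^ 2) * (1 + s ^ 2)⁻¹) =
      ENNReal.ofReal (C / n ^ 2) := by
    rw [← ofReal_integral_eq_lintegral_ofReal (integrable_inv_one_add_sq.const_mul _)
      (Filter.Eventually.of_forall fun s => by positivity), integral_const_mul,
      integral_univ_inv_one_add_sq]
    congr 1
    field_simp
  calc _ ≤ 4 * (2 * ∫⁻ s : ℝ, ENNReal.ofReal (C / (π * n ^ 2) * (1 + s ^ 2)⁻¹)) := by
        gcongr with s
        exact h2 s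
    _ = _ := by
      rw [h4, ← mul_assoc, ← ENNReal.ofReal_ofNat 4, ← ENNReal.ofReal_ofNat 2,
        ← ENNReal.ofReal_mul (by norm_num), ← ENNReal.ofReal_mul (by norm_num)]
      congr 1
      ring

/-- The smoothed integrand is factored as `logWeight` times Y, where Y has Gaussian second moment at
most C/(π²n²) uniformly in s. Cauchy–Schwarz costs one total mass of the weight and the remaining
s-integral another, whence the square of the logarithm. -/
theorem lintegral_sphere_kolmogorov_le {R C : ℝ} (hR : ∀ᵐ y ∂Q, ‖y‖ ≤ R) (hn : 2 ≤ n) (hC : 0 ≤ C)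
    (hM : ∀ s : ℝ, ∫ x, charDiff Q ((s / √n) • x) ^ 2 ∂(stdGaussMeasure n) ≤
      C * min 1 (s ^ 2) / n ^ 2) :
    ∫⁻ θ : Metric.sphere (0 : EuclideanSpace ℝ (Fin n)) 1,
      ENNReal.ofReal (kolmogorovDist (cdf (projLaw Q θ)) stdNormalCDF ^ 2) ∂(sphereMeasure n) ≤
      ENNReal.ofReal ((64 * C + 5000) * log n ^ 2 / n ^ 2) := by
  have hn0 : (0 : ℝ) < n := by exact_mod_cast (by omega : 0 < n)
  have hcont := continuous_charDiff Q
  have hmeas : MeasurableSet {x : EuclideanSpace ℝ (Fin n) | √n / 2 ≤ ‖x‖} :=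
    measurableSet_le measurable_const measurable_norm
  have hlog : 0 ≤ log n := log_nonneg (by exact_mod_cast (by omega : 1 ≤ n))
  have hmin : ∀ s : ℝ, 0 ≤ min 1 |s| := fun s => le_min zero_le_one (abs_nonneg s)
  have hw := (measurable_logWeight n).ennreal_ofReal
  refine (lintegral_sphereMeasure_le hn
    ((measurable_kolmogorovDist_projLaw (Q := Q)).pow_const 2).ennreal_ofReal).trans ?_
  set Y : EuclideanSpace ℝ (Fin n) → ℝ → ENNReal := fun x s =>
    ENNReal.ofReal (π⁻¹ * (charDiff Q ((s / √n) • x) / min 1 |s|)) with hY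
  have hjm : Measurable (Function.uncurry Y) := by
    simp only [hY, Function.uncurry_def]
    have : Measurable fun p : EuclideanSpace ℝ (Fin n) × ℝ => charDiff Q ((p.2 / √n) • p.1) :=
      (by fun_prop : Continuous fun p : EuclideanSpace ℝ (Fin n) × ℝ =>
        charDiff Q ((p.2 / √n) • p.1)).measurable
    fun_prop
  have hpt : ∀ x : EuclideanSpace ℝ (Fin n), √n / 2 ≤ ‖x‖ →
      ENNReal.ofReal (kolmogorovDist (cdf (projLaw Q (‖x‖⁻¹ • x))) stdNormalCDF ^ 2) ≤
      2 * ((∫⁻ s, ENNReal.ofReal (logWeight n s)) *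
        ∫⁻ s, ENNReal.ofReal (logWeight n s) * Y x s ^ 2) + ENNReal.ofReal (512 / n ^ 2) := by
    intro x hx
    have h1 := ofReal_kolmogorovDist_projLaw_le hR (by omega) hx
    rw [ENNReal.ofReal_pow (kolmogorovDist_cdf_nonneg _)]
    have h2 : ∫⁻ s, ENNReal.ofReal (π⁻¹ * exp (-(s ^ 2 / (2 * n ^ 2))) *
        (charDiff Q ((s / √n) • x) / |s|)) = ∫⁻ s, ENNReal.ofReal (logWeight n s) * Y x s := by
      refine lintegral_congr fun s => ?_
      rw [hY, ← ENNReal.ofReal_mul (logWeight_nonneg n s)]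
      congr 1
      -- At s = 0 both sides vanish by the convention that division by zero gives zero.
      rcases eq_or_ne s 0 with rfl | hs
      · simp [logWeight]
      have : 0 < min 1 |s| := lt_min zero_lt_one (abs_pos.2 hs)
      rw [logWeight]
      field_simp
    rw [h2] at h1
    have h3 := lintegral_mul_sq_le (μ := (volume : Measure ℝ)) hw (hjm.of_uncurry_left (x := x))
    calc _ ≤ ((∫⁻ s, ENNReal.ofReal (logWeight n s) * Y x s) + ENNReal.ofReal (16 / n)) ^ 2 := by
          gcongr
      _ ≤ 2 * ((∫⁻ s, ENNReal.ofReal (logWeight n s) * Y x s) ^ 2 +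
            ENNReal.ofReal (16 / n) ^ 2) := by
          have := ENNReal.rpow_add_le_mul_rpow_add_rpow
            (∫⁻ s, ENNReal.ofReal (logWeight n s) * Y x s) (ENNReal.ofReal (16 / n))
            (one_le_two : (1 : ℝ) ≤ 2)
          norm_num at this
          exact this
      _ ≤ _ := by
          rw [mul_add]
          gcongr
          rw [← ENNReal.ofReal_pow (by positivity), ← ENNReal.ofReal_ofNat 2,
            ← ENNReal.ofReal_mul (by norm_num)]
          refine ENNReal.ofReal_le_ofReal (le_of_eq ?_)
          ring
  set W := ∫⁻ s, ENNReal.ofReal (logWeight n s) with hWdef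
  have hW : W ≤ ENNReal.ofReal (8 * log n) := lintegral_logWeight_le hn
  have h1 : ∫⁻ x in {x | √n / 2 ≤ ‖x‖}, ENNReal.ofReal
      (kolmogorovDist (cdf (projLaw Q (‖x‖⁻¹ • x))) stdNormalCDF ^ 2) ∂(stdGaussMeasure n) ≤
      ∫⁻ x, (2 * (W * ∫⁻ s, ENNReal.ofReal (logWeight n s) * Y x s ^ 2) +
        ENNReal.ofReal (512 / n ^ 2)) ∂(stdGaussMeasure n) :=
    (setLIntegral_mono' hmeas fun x hx => hpt x hx).trans (setLIntegral_le_lintegral _ _)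
  have hjm2 : Measurable (Function.uncurry fun x s =>
      ENNReal.ofReal (logWeight n s) * Y x s ^ 2) := by
    simp only [Function.uncurry_def]
    exact (hw.comp measurable_snd).mul (hjm.pow_const 2)
  have h2 : ∀ s : ℝ, ∫⁻ x, ENNReal.ofReal (logWeight n s) * Y x s ^ 2 ∂(stdGaussMeasure n) ≤
      ENNReal.ofReal (logWeight n s) * ENNReal.ofReal (C / (π ^ 2 * n ^ 2)) := by
    intro s
    rw [lintegral_const_mul _ ((hjm.of_uncurry_right (y := s)).pow_const 2)]
    gcongr
    have h3 : ∀ x, Y x s ^ 2 = ENNReal.ofReal (1 / (π ^ 2 * min 1 |s| ^ 2)) *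
        ENNReal.ofReal (charDiff Q ((s / √n) • x) ^ 2) := by
      intro x
      have := charDiff_nonneg Q ((s / √n) • x)
      have := hmin s
      rw [hY, ← ENNReal.ofReal_pow (by positivity), ← ENNReal.ofReal_mul (by positivity)]
      congr 1
      field_simp
    simp_rw [h3]
    rw [lintegral_const_mul _ (by fun_prop)]
    refine (mul_le_mul_right (lintegral_charDiff_sq_le hM s) _).trans ?_
    have := hmin s
    rw [← ENNReal.ofReal_mul (by positivity), min_one_abs_sq]
    refine ENNReal.ofReal_le_ofReal ?_
    rcases eq_or_ne s 0 with rfl | hs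
    · simp; positivity
    have : 0 < min 1 (s ^ 2) := lt_min zero_lt_one (by positivity)
    refine le_of_eq ?_
    field_simp
  have h5 : ∫⁻ x, (∫⁻ s, ENNReal.ofReal (logWeight n s) * Y x s ^ 2) ∂(stdGaussMeasure n) ≤
      W * ENNReal.ofReal (C / (π ^ 2 * n ^ 2)) := by
    rw [lintegral_lintegral_swap hjm2.aemeasurable, hWdef, ← lintegral_mul_const _ hw]
    exact lintegral_mono h2
  have h6 : ∫⁻ x, (2 * (W * ∫⁻ s, ENNReal.ofReal (logWeight n s) * Y x s ^ 2) +
        ENNReal.ofReal (512 / n ^ 2)) ∂(stdGaussMeasure n) ≤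
      2 * (W * (W * ENNReal.ofReal (C / (π ^ 2 * n ^ 2)))) + ENNReal.ofReal (512 / n ^ 2) := by
    have hm2 : Measurable fun x => ∫⁻ s, ENNReal.ofReal (logWeight n s) * Y x s ^ 2 :=
      hjm2.lintegral_prod_right'
    rw [lintegral_add_right _ measurable_const, lintegral_const_mul _ (hm2.const_mul _),
      lintegral_const_mul _ hm2]
    simp only [lintegral_const, measure_univ, mul_one]
    gcongr
  refine (mul_le_mul_right (h1.trans h6) 4).trans ?_
  calc 4 * (2 * (W * (W * ENNReal.ofReal (C / (π ^ 2 * n ^ 2)))) + ENNReal.ofReal (512 / n ^ 2))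
      ≤ 4 * (2 * (ENNReal.ofReal (8 * log n) * (ENNReal.ofReal (8 * log n) *
        ENNReal.ofReal (C / (π ^ 2 * n ^ 2)))) + ENNReal.ofReal (512 / n ^ 2)) := by gcongr
    _ = ENNReal.ofReal (4 * (2 * ((8 * log n) * ((8 * log n) * (C / (π ^ 2 * n ^ 2)))) +
        512 / n ^ 2)) := by
        rw [ENNReal.ofReal_mul (p := 4) (by norm_num),
          ENNReal.ofReal_add (by positivity) (by positivity),
          ENNReal.ofReal_mul (p := 2) (by norm_num),
          ENNReal.ofReal_mul (p := 8 * log n) (by positivity),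
          ENNReal.ofReal_mul (p := 8 * log n) (by positivity),
          ENNReal.ofReal_ofNat, ENNReal.ofReal_ofNat]
    _ ≤ _ := by
        refine ENNReal.ofReal_le_ofReal ?_
        -- The smoothing error 2048/n² carries no logarithm; since n ≥ 2 it is absorbed, as 2048 ·
        -- 2.2 < 5000. Likewise 512/9 < 64.
        have hl : (1 : ℝ) ≤ 2.2 * log n ^ 2 := by
          have h2 : log 2 ≤ log n := log_le_log (by norm_num) (by exact_mod_cast hn)
          have h3 := log_two_gt_d9
          nlinarith
        have hpi : C / π ^ 2 ≤ C / 9 := by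
          have := pi_gt_three
          gcongr
          nlinarith
        have e1 : 4 * (2 * ((8 * log n) * ((8 * log n) * (C / (π ^ 2 * n ^ 2)))) + 512 / n ^ 2) =
            (512 * log n ^ 2 * (C / π ^ 2) + 2048) / n ^ 2 := by field_simp; ring
        rw [e1]
        gcongr
        have : 512 * log n ^ 2 * (C / π ^ 2) ≤ 512 * log n ^ 2 * (C / 9) := by gcongr
        nlinarith [mul_nonneg (sq_nonneg (log n)) hC]

end Average

/-! ### The trigonometric system -/

instance isProbabilityMeasure_circleProb : IsProbabilityMeasure circleProb := by
  constructor
  rw [circleProb, Measure.smul_apply, Measure.restrict_apply_univ, volume_Ioo, smul_eq_mul,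
    ← ENNReal.ofReal_mul (by positivity), ENNReal.ofReal_eq_one]
  field_simp
  ring

theorem integral_cexp_circleProb (a : ℤ) :
    ∫ t, Complex.exp ((a * t : ℝ) * Complex.I) ∂circleProb = if a = 0 then 1 else 0 := by
  split_ifs with h
  · simp [h]
  · have haI : (a : ℂ) * Complex.I ≠ 0 := by simp [h]
    rw [circleProb, integral_smul_measure, ← integral_Ioc_eq_integral_Ioo,
      ← intervalIntegral.integral_of_le (by linarith [pi_pos])]
    have h1 : ∀ t : ℝ, Complex.exp ((a * t : ℝ) * Complex.I) =
        Complex.exp ((a * Complex.I) * t) := fun t => by congr 1; push_cast; ring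
    simp_rw [h1]
    rw [integral_exp_mul_complex haI]
    have h2 : Complex.exp (a * Complex.I * π) = Complex.exp (a * Complex.I * (-π : ℝ)) := by
      rw [Complex.exp_eq_exp_iff_exists_int]
      exact ⟨a, by push_cast; ring⟩
    rw [h2, sub_self, zero_div, smul_zero]

/-- The character `(t, u) ↦ exp(ia(t - u))`. -/
noncomputable def diffChar (a : ℤ) (p : ℝ × ℝ) : ℂ :=
  Complex.exp ((a * (p.1 - p.2) : ℝ) * Complex.I)

theorem diffChar_mul (a b : ℤ) (p : ℝ × ℝ) : diffChar a p * diffChar b p = diffChar (a + b) p := by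
  rw [diffChar, diffChar, diffChar, ← Complex.exp_add]
  congr 1
  push_cast
  ring

theorem integrable_diffChar (a : ℤ) : Integrable (diffChar a) (circleProb.prod circleProb) := by
  refine integrable_of_continuous_of_norm_le_one ?_ fun p =>
    (Complex.norm_exp_ofReal_mul_I _).le
  unfold diffChar
  fun_prop

theorem integral_diffChar (a : ℤ) :
    ∫ p, diffChar a p ∂(circleProb.prod circleProb) = if a = 0 then 1 else 0 := by
  have h1 : ∀ p : ℝ × ℝ, diffChar a p = Complex.exp ((a * p.1 : ℝ) * Complex.I) *
      Complex.exp (((-a : ℤ) * p.2 : ℝ) * Complex.I) := by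
    intro p
    rw [diffChar, ← Complex.exp_add]
    congr 1
    push_cast
    ring
  simp_rw [h1]
  rw [integral_prod_mul (fun t : ℝ => Complex.exp ((a * t : ℝ) * Complex.I))
    (fun t : ℝ => Complex.exp (((-a : ℤ) * t : ℝ) * Complex.I)), integral_cexp_circleProb,
    integral_cexp_circleProb]
  by_cases h : a = 0 <;> simp [h]

/-- By orthogonality, expanding a power of the correlation into characters turns its moment into the
number of zero-sum tuples of frequencies. -/
theorem integral_sum_diffChar {ι : Type*} (s : Finset ι) (f : ι → ℤ) :
    ∫ p, ∑ i ∈ s, diffChar (f i) p ∂(circleProb.prod circleProb) =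
      ((s.filter fun i => f i = 0).card : ℂ) := by
  rw [integral_finsetSum _ fun i _ => integrable_diffChar _]
  simp_rw [integral_diffChar]
  simp

theorem sum_diffChar_sq (A : Finset ℤ) (p : ℝ × ℝ) :
    (∑ a ∈ A, diffChar a p) ^ 2 = ∑ r ∈ A ×ˢ A, diffChar (r.1 + r.2) p := by
  rw [sq, Finset.sum_mul_sum, Finset.sum_product]
  simp_rw [diffChar_mul]

theorem sum_diffChar_cube (A : Finset ℤ) (p : ℝ × ℝ) :
    (∑ a ∈ A, diffChar a p) ^ 3 = ∑ r ∈ A ×ˢ (A ×ˢ A), diffChar (r.2.1 + r.2.2 + r.1) p := by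
  rw [pow_succ', sum_diffChar_sq, Finset.sum_mul_sum, Finset.sum_product]
  simp_rw [diffChar_mul, add_comm]

theorem sum_diffChar_pow_four (A : Finset ℤ) (p : ℝ × ℝ) :
    (∑ a ∈ A, diffChar a p) ^ 4 =
      ∑ r ∈ (A ×ˢ A) ×ˢ (A ×ˢ A), diffChar (r.2.1 + r.2.2 + (r.1.1 + r.1.2)) p := by
  rw [show 4 = 2 * 2 from rfl, pow_mul, sq, sum_diffChar_sq, Finset.sum_mul_sum,
    Finset.sum_product (s := A ×ˢ A)]
  simp_rw [diffChar_mul, add_comm]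

theorem card_filter_product_add_eq_zero {ι κ : Type*} (s : Finset ι) (t : Finset κ)
    (f : ι → ℤ) (g : κ → ℤ) :
    ((s ×ˢ t).filter fun r => g r.2 + f r.1 = 0).card =
      ∑ i ∈ s, (t.filter fun j => g j = -f i).card := by
  rw [Finset.card_filter, Finset.sum_product]
  refine Finset.sum_congr rfl fun i _ => ?_
  rw [Finset.card_filter]
  refine Finset.sum_congr rfl fun j _ => ?_
  simp only [add_eq_zero_iff_eq_neg]

/-- The vector of values of the trigonometric system. -/
noncomputable def trigVector (n : ℕ) (m : ℕ → ℕ) (t : ℝ) : EuclideanSpace ℝ (Fin n) :=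
  WithLp.toLp 2 fun i => trigSystem n m i t

theorem continuous_trigVector (n : ℕ) (m : ℕ → ℕ) : Continuous (trigVector n m) := by
  unfold trigVector
  refine (PiLp.continuous_toLp 2 _).comp (continuous_pi fun i => ?_)
  unfold trigSystem
  split_ifs <;> fun_prop

theorem sum_range_two_mul {M : Type*} [AddCommMonoid M] (f : ℕ → M) (N : ℕ) :
    ∑ i ∈ Finset.range (2 * N), f i = ∑ k ∈ Finset.Icc 1 N, (f (2 * k - 2) + f (2 * k - 1)) := by
  induction N with
  | zero => simp
  | succ N ih =>
    rw [show 2 * (N + 1) = 2 * N + 1 + 1 by ring, Finset.sum_range_succ, Finset.sum_range_succ, ih,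
      Finset.sum_Icc_succ_top (by omega), add_assoc]
    congr 3

theorem inner_trigVector {n N : ℕ} (hn : n = 2 * N) (m : ℕ → ℕ) (t u : ℝ) :
    inner ℝ (trigVector n m t) (trigVector n m u) =
      ∑ k ∈ Finset.Icc 1 N, 2 * cos (m k * (t - u)) := by
  subst hn
  obtain ⟨g, hg⟩ : ∃ g : ℕ → ℝ, g = fun i =>
      (if Even i then √2 * cos ((m (i / 2 + 1) : ℝ) * t)
        else √2 * sin ((m (i / 2 + 1) : ℝ) * t)) *
      (if Even i then √2 * cos ((m (i / 2 + 1) : ℝ) * u)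
        else √2 * sin ((m (i / 2 + 1) : ℝ) * u)) := ⟨_, rfl⟩
  have h1 : inner ℝ (trigVector (2 * N) m t) (trigVector (2 * N) m u) =
      ∑ i : Fin (2 * N), g i := by
    rw [PiLp.inner_apply]
    refine Finset.sum_congr rfl fun i _ => ?_
    simp only [hg, trigVector, trigSystem, RCLike.inner_apply, conj_trivial]
    exact mul_comm _ _
  rw [h1, Fin.sum_univ_eq_sum_range, sum_range_two_mul]
  refine Finset.sum_congr rfl fun k hk => ?_
  have hk1 := (Finset.mem_Icc.1 hk).1
  have e1 : Even (2 * k - 2) := ⟨k - 1, by omega⟩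
  have e2 : ¬ Even (2 * k - 1) := by rw [Nat.not_even_iff_odd]; exact ⟨k - 1, by omega⟩
  have e3 : (2 * k - 2) / 2 + 1 = k := by omega
  have e4 : (2 * k - 1) / 2 + 1 = k := by omega
  simp only [hg, e1, e2, e3, e4, if_true, if_false]
  rw [mul_sub, cos_sub]
  have h2 : √2 * √2 = (2 : ℝ) := mul_self_sqrt (by norm_num)
  linear_combination (cos (m k * t) * cos (m k * u) + sin (m k * t) * sin (m k * u)) * h2

/-- Each cosine–sine pair contributes 2(cos² + sin²) = 2. The constant length makes the cross term
of the mean square deterministic and reduces ‖X - Y‖ to the correlation. -/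
theorem norm_sq_trigVector {n : ℕ} (hn : Even n) (m : ℕ → ℕ) (t : ℝ) :
    ‖trigVector n m t‖ ^ 2 = n := by
  obtain ⟨N, hN⟩ := hn.two_dvd
  rw [← real_inner_self_eq_norm_sq, inner_trigVector hN, hN]
  simp [mul_comm]

theorem IsLacunary.inner_trigVector_eq_sum {q : ℝ} (hq : 1 < q) {n N : ℕ} (hn : n = 2 * N)
    {m : ℕ → ℕ} (h : IsLacunary q N m) (p : ℝ × ℝ) :
    ((inner ℝ (trigVector n m p.1) (trigVector n m p.2) : ℝ) : ℂ) =
      ∑ a ∈ freqSet m N, diffChar a p := by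
  rw [inner_trigVector hn, h.sum_freqSet hq]
  push_cast
  refine Finset.sum_congr rfl fun k _ => ?_
  rw [Complex.cos, diffChar, diffChar, mul_div_cancel₀ _ two_ne_zero]
  congr 2
  · push_cast; ring
  · push_cast; ring

theorem IsLacunary.integral_inner_pow {q : ℝ} (hq : 1 < q) {n N : ℕ} (hn : n = 2 * N)
    {m : ℕ → ℕ} (h : IsLacunary q N m) (k : ℕ) {ι : Type*} (s : Finset ι) (f : ι → ℤ)
    (hs : ∀ p, (∑ a ∈ freqSet m N, diffChar a p) ^ k = ∑ i ∈ s, diffChar (f i) p) :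
    ∫ p : ℝ × ℝ, (inner ℝ (trigVector n m p.1) (trigVector n m p.2) / n) ^ k
      ∂(circleProb.prod circleProb) = ((s.filter fun i => f i = 0).card : ℝ) / n ^ k := by
  simp_rw [div_pow]
  rw [integral_div]
  congr 1
  rw [← Complex.ofReal_inj, ← integral_complex_ofReal]
  simp_rw [Complex.ofReal_pow, h.inner_trigVector_eq_sum hq hn, hs]
  rw [integral_sum_diffChar]
  simp

/-- The mean square distance of the characteristic functions for lacunary trigonometric systems. -/
theorem IsLacunary.integral_charDiff_sq_le {q : ℝ} (hq : 1 < q) {n : ℕ} (hn2 : 2 ≤ n)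
    (hn : Even n) {m : ℕ → ℕ} (h : IsLacunary q (n / 2) m) {L : ℕ}
    (hL : 2 * q / (q - 1) < q ^ L) (s : ℝ) :
    ∫ x, charDiff (circleProb.map (trigVector n m)) ((s / √n) • x) ^ 2 ∂(stdGaussMeasure n) ≤
      (1201 * (4 * L + 1) + 409) * min 1 (s ^ 2) / n ^ 2 := by
  have hn0 : (0 : ℝ) < n := by exact_mod_cast (by omega : 0 < n)
  have hN : n = 2 * (n / 2) := by have := hn.two_dvd; omega
  have hcard : (freqSet m (n / 2)).card = n := by rw [h.card_freqSet hq]; omega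
  have hX := (continuous_trigVector n m).measurable
  have : IsProbabilityMeasure (circleProb.map (trigVector n m)) :=
    Measure.isProbabilityMeasure_map hX.aemeasurable
  set ξ : ℝ × ℝ → ℝ := fun p => inner ℝ (trigVector n m p.1) (trigVector n m p.2) / n with hξ
  have hcont := continuous_trigVector n m
  have hξm : Measurable ξ := by
    have : Continuous ξ := by simp only [hξ]; fun_prop
    exact this.measurable
  have hξ1 : ∀ p, |ξ p| ≤ 1 := by
    intro p
    rw [hξ, abs_div, Nat.abs_cast, div_le_one hn0]
    refine (abs_real_inner_le_norm _ _).trans ?_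
    have h1 := norm_sq_trigVector hn m p.1
    have h2 := norm_sq_trigVector hn m p.2
    nlinarith [sq_nonneg (‖trigVector n m p.1‖ - ‖trigVector n m p.2‖)]
  have m1 : ∫ p, ξ p ∂(circleProb.prod circleProb) = 0 := by
    have := h.integral_inner_pow hq hN 1 (freqSet m (n / 2)) id (fun p => by simp)
    simp only [pow_one] at this
    rw [hξ, this, Finset.filter_eq_empty_iff.2, Finset.card_empty, Nat.cast_zero, zero_div]
    rintro a ha h0
    exact h.zero_notMem (show (0 : ℤ) ∈ _ from h0 ▸ ha)
  have m2 : ∫ p, ξ p ^ 2 ∂(circleProb.prod circleProb) = 1 / n := by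
    have := h.integral_inner_pow hq hN 2 _ _ (sum_diffChar_sq _)
    rw [hξ, this, card_add_eq_zero, hcard]
    field_simp
  have m3 : ∫ p, ξ p ^ 3 ∂(circleProb.prod circleProb) ≤ (4 * L + 1) / n ^ 2 := by
    have := h.integral_inner_pow hq hN 3 _ _ (sum_diffChar_cube _)
    rw [hξ, this, card_filter_product_add_eq_zero _ _ (fun a => a) (fun r : ℤ × ℤ => r.1 + r.2)]
    have h3 : ((∑ a ∈ freqSet m (n / 2), ((freqSet m (n / 2) ×ˢ freqSet m (n / 2)).filter
        (fun p => p.1 + p.2 = -a)).card : ℕ) : ℝ) ≤ 4 * L * n := by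
      have := h.card_add_add_eq_zero_le hq hL
      rw [hcard] at this
      exact_mod_cast this
    calc _ ≤ 4 * L * n / (n : ℝ) ^ 3 := by gcongr
      _ = 4 * L / (n : ℝ) ^ 2 := by field_simp
      _ ≤ _ := by gcongr; linarith
  have m4 : ∫ p, ξ p ^ 4 ∂(circleProb.prod circleProb) ≤ (4 * L + 1) / n ^ 2 := by
    have := h.integral_inner_pow hq hN 4 _ _ (sum_diffChar_pow_four _)
    rw [hξ, this, card_filter_product_add_eq_zero _ _ (fun r : ℤ × ℤ => r.1 + r.2)
      (fun r : ℤ × ℤ => r.1 + r.2)]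
    have h3 : ((∑ r ∈ freqSet m (n / 2) ×ˢ freqSet m (n / 2),
        ((freqSet m (n / 2) ×ˢ freqSet m (n / 2)).filter
        (fun p => p.1 + p.2 = -(r.1 + r.2))).card : ℕ) : ℝ) ≤ (4 * L + 1) * n ^ 2 := by
      have := h.card_add_eq_add_le hq hL
      rw [hcard] at this
      exact_mod_cast this
    calc _ ≤ (4 * L + 1) * n ^ 2 / (n : ℝ) ^ 4 := by gcongr
      _ = _ := by field_simp
  have hbound := exp_neg_mul_integral_exp_sub_add_le (circleProb.prod circleProb) hξm hξ1
    (by exact_mod_cast hn2 : (2 : ℝ) ≤ n) (by positivity) m1 m2 m3 m4 (sq_nonneg s)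
  unfold charDiff
  rw [integral_norm_charFun_sub_exp_sq]
  have hc : (s / √n) ^ 2 = s ^ 2 / n := by rw [div_pow, sq_sqrt hn0.le]
  -- Both vectors have squared length n, so ‖X - Y‖² = 2n(1 - ξ) and the exponent becomes -s² + s²ξ.
  have e1 : ∫ p, exp (-((s / √n) ^ 2 * ‖p.1 - p.2‖ ^ 2 / 2))
      ∂((circleProb.map (trigVector n m)).prod (circleProb.map (trigVector n m))) =
      exp (-s ^ 2) * ∫ p, exp (s ^ 2 * ξ p) ∂(circleProb.prod circleProb) := by
    rw [Measure.map_prod_map _ _ hX hX, integral_map (by fun_prop) (by fun_prop),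
      ← integral_const_mul]
    refine integral_congr_ae (Filter.Eventually.of_forall fun p => ?_)
    simp only [Prod.map]
    rw [← exp_add, hc, norm_sub_sq_real, norm_sq_trigVector hn, norm_sq_trigVector hn, hξ]
    congr 1
    field_simp
    ring
  have e2 : ∫ y, (1 + (s / √n) ^ 2) ^ (-(n / 2 : ℝ)) *
      exp (-((s / √n) ^ 2 * ‖y‖ ^ 2 / (2 * (1 + (s / √n) ^ 2))))
      ∂(circleProb.map (trigVector n m)) =
      (1 + s ^ 2 / n) ^ (-(n / 2 : ℝ)) * exp (-(s ^ 2 / (2 * (1 + s ^ 2 / n)))) := by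
    rw [integral_map hX.aemeasurable (by fun_prop)]
    simp_rw [norm_sq_trigVector hn, hc, div_mul_cancel₀ _ hn0.ne']
    simp
  rw [e1, e2, hc]
  exact hbound

theorem weightedDistFun_eq_cdf {n : ℕ} (m : ℕ → ℕ) (θ : EuclideanSpace ℝ (Fin n)) :
    weightedDistFun circleProb (trigSystem n m) θ =
      cdf (projLaw (circleProb.map (trigVector n m)) θ) := by
  have hX := (continuous_trigVector n m).measurable
  have : IsProbabilityMeasure (circleProb.map (trigVector n m)) :=
    Measure.isProbabilityMeasure_map hX.aemeasurable
  ext x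
  rw [cdf_eq_real, projLaw, Measure.map_map (by fun_prop) hX,
    map_measureReal_apply (by fun_prop) measurableSet_Iic, weightedDistFun]
  congr 1

theorem integrable_and_integral_le_of_lintegral_le {α : Type*} [MeasurableSpace α] {μ : Measure α}
    {f : α → ℝ} (hf : Measurable f) (h0 : ∀ a, 0 ≤ f a) {K : ℝ} (hK : 0 ≤ K)
    (h : ∫⁻ a, ENNReal.ofReal (f a) ∂μ ≤ ENNReal.ofReal K) :
    Integrable f μ ∧ ∫ a, f a ∂μ ≤ K := by
  have hint : Integrable f μ := by
    refine ⟨hf.aestronglyMeasurable, ?_⟩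
    rw [hasFiniteIntegral_iff_ofReal (Filter.Eventually.of_forall h0)]
    exact h.trans_lt ENNReal.ofReal_lt_top
  refine ⟨hint, ?_⟩
  rw [← ofReal_integral_eq_lintegral_ofReal hint (Filter.Eventually.of_forall h0)] at h
  exact (ENNReal.ofReal_le_ofReal_iff hK).1 h

theorem proposition15p1 (q : ℝ) (hq : 1 < q) :
    ∃ c : ℝ, 0 < c ∧ ∀ (n : ℕ), 2 ≤ n → Even n → ∀ (m : ℕ → ℕ), IsLacunary q (n / 2) m →
      -- the squared `L²`-distance is finite for every `θ`, and its mean is at most `c / n²`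
      (∀ θ : Metric.sphere (0 : EuclideanSpace ℝ (Fin n)) 1,
        Integrable (fun x : ℝ =>
          (weightedDistFun circleProb (trigSystem n m) θ x - stdNormalCDF x) ^ 2)) ∧
      Integrable (fun θ : Metric.sphere (0 : EuclideanSpace ℝ (Fin n)) 1 =>
        l2Dist (weightedDistFun circleProb (trigSystem n m) θ) stdNormalCDF ^ 2)
        (sphereMeasure n) ∧
      ∫ θ : Metric.sphere (0 : EuclideanSpace ℝ (Fin n)) 1,
        l2Dist (weightedDistFun circleProb (trigSystem n m) θ) stdNormalCDF ^ 2
          ∂(sphereMeasure n) ≤ c / (n : ℝ) ^ 2 ∧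
      -- the mean of the squared Kolmogorov distance is at most `c (log n)² / n²`
      Integrable (fun θ : Metric.sphere (0 : EuclideanSpace ℝ (Fin n)) 1 =>
        kolmogorovDist (weightedDistFun circleProb (trigSystem n m) θ) stdNormalCDF ^ 2)
        (sphereMeasure n) ∧
      ∫ θ : Metric.sphere (0 : EuclideanSpace ℝ (Fin n)) 1,
        kolmogorovDist (weightedDistFun circleProb (trigSystem n m) θ) stdNormalCDF ^ 2
          ∂(sphereMeasure n) ≤ c * Real.log n ^ 2 / (n : ℝ) ^ 2 := by
  -- The parameter q enters the constant only through L, which is fixed before n and the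
  -- frequencies.
  obtain ⟨L, hL⟩ := pow_unbounded_of_one_lt (2 * q / (q - 1)) hq
  set C : ℝ := 1201 * (4 * L + 1) + 409 with hC
  have hC0 : 0 ≤ C := by positivity
  refine ⟨64 * C + 5000, by positivity, fun n hn2 hn m h => ?_⟩
  set Q := circleProb.map (trigVector n m) with hQ
  have hX := (continuous_trigVector n m).measurable
  have : IsProbabilityMeasure Q := Measure.isProbabilityMeasure_map hX.aemeasurable
  have hR : ∀ᵐ y ∂Q, ‖y‖ ≤ √n := by
    rw [hQ, ae_map_iff hX.aemeasurable (measurableSet_le measurable_norm measurable_const)]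
    refine Filter.Eventually.of_forall fun t => ?_
    exact Real.le_sqrt_of_sq_le (norm_sq_trigVector hn m t).le
  have hM : ∀ s : ℝ, ∫ x, charDiff Q ((s / √n) • x) ^ 2 ∂(stdGaussMeasure n) ≤
      C * min 1 (s ^ 2) / n ^ 2 := fun s => h.integral_charDiff_sq_le hq hn2 hn hL s
  have hω := lintegral_sphere_l2_le hR hn2 hC0 hM
  have hρ := lintegral_sphere_kolmogorov_le hR hn2 hC0 hM
  have hl2 : ∀ θ : EuclideanSpace ℝ (Fin n), l2Dist (cdf (projLaw Q θ)) stdNormalCDF ^ 2 =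
      ∫ y, (cdf (projLaw Q θ) y - stdNormalCDF y) ^ 2 := fun θ =>
    sq_sqrt (integral_nonneg fun y => sq_nonneg _)
  simp only [weightedDistFun_eq_cdf, ← hQ, hl2]
  obtain ⟨i1, b1⟩ := integrable_and_integral_le_of_lintegral_le
    ((measurable_integral_cdf_projLaw_sub_sq (Q := Q)).comp measurable_subtype_coe)
    (fun θ => integral_nonneg fun y => sq_nonneg _) (by positivity) hω
  obtain ⟨i2, b2⟩ := integrable_and_integral_le_of_lintegral_le
    (((measurable_kolmogorovDist_projLaw (Q := Q)).comp measurable_subtype_coe).pow_const 2)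
    (fun θ => sq_nonneg _) (by positivity) hρ
  refine ⟨fun θ => integrable_cdf_sub_stdNormalCDF_sq (integrable_id_projLaw hR θ), i1,
    b1.trans ?_, i2, b2⟩
  gcongr
  linarith
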